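/- Let $Q$ be a smooth (finite-dimensional, Hausdorff) manifold without boundary, with tangent bundle $\pi\colon TQ\to Q$. A (possibly non-reversible) Finsler metric on $Q$ is a function $F\colon TQ\to[0,\infty)$ such that (i) $G:=F^2/2$ is smooth outside the zero section; (ii) $F(q,v)=0$ if and only if $v=0$; (iii) $F(q,\rho v)=\rho F(q,v)$ for all $\rho>0$; (iv) for every $q\in Q$ the function $v\mapsto G(q,v)$ has positive definite Hessian at every $v\in T_qQ\setminus\{0\}$. Let $F$ be such a metric. Let $\beta=\frac{\partial F}{\partial v^i}\,dq^i$ be its Hilbert form on $TQ\setminus Q$, let $\alpha:=F\beta$, and let $M:=F^{-1}(1)\subset TQ$, with tangent spaces $T_xM=\ker d_xF$. Then $\alpha|_{TM}$ is a contact form (that is, it vanishes nowhere and $d\alpha$ is non-degenerate on the hyperplanes $\ker\alpha\cap TM$), and the equations $\alpha(R)=1$ and $d\alpha(R,\cdot)|_{TM}=0$ determine a unique vector field $R$ tangent to $M$, the Reeb vector field. Moreover, the unit speed geodesics of $F$ are precisely the projections of Reeb orbits on $M$: for every interval $J\subset\mathbb R$ with more than one point, a curve $\gamma\colon J\to Q$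 is a unit speed geodesic if and only if there is an integral curve $\Gamma\colon J\to M$ of $R$ with $\pi\circ\Gamma=\gamma$. Here $\gamma\colon J\to Q$ is a unit speed geodesic if it is smooth, $F(\gamma(t),\dot\gamma(t))=1$ for all $t\in J$, and for every $[a,b]\subset J$ with $a<b$ the restriction $\gamma|_{[a,b]}$ is a critical point of the length functional $L(c)=\int_a^b F(c(t),\dot c(t))\,dt$, i.e. for every smooth variation $(s,t)\mapsto\gamma_s(t)$, $s\in(-\varepsilon,\varepsilon)$, $t\in[a,b]$, with $\gamma_0=\gamma|_{[a,b]}$ and $\gamma_s=\gamma$ near $a$ and $b$, the function $s\mapsto L(\gamma_s)$ is differentiable at $s=0$ with derivative $0$. -/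

import Mathlib

open Set
open scoped Manifold ContDiff Topology

noncomputable section

section ExteriorDerivative

variable {E' : Type*} [NormedAddCommGroup E'] [NormedSpace ℝ E']
  {H' : Type*} [TopologicalSpace H'] {N : Type*} [TopologicalSpace N] [ChartedSpace H' N]

/-- The representation, in the preferred chart at `x₀`, of a `1`-form `θ` on a manifold `N`
(without boundary): the pull-back of `θ` under the inverse of the chart, seen as a `1`-form on
(an open subset of) the model vector space. -/
def oneFormInChart (I' : ModelWithCorners ℝ E' H') (θ : (x : N) → TangentSpace I' x →L[ℝ] ℝ)
    (x₀ : N) (y : E') : E' [⋀^Fin 1]→L[ℝ] ℝ :=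
  ContinuousAlternatingMap.ofSubsingleton ℝ E' ℝ (0 : Fin 1)
    ((θ ((extChartAt I' x₀).symm y)).comp (mfderiv 𝓘(ℝ, E') I' (extChartAt I' x₀).symm y))

/-- The exterior derivative `(dθ)_x(u, w)` of a `1`-form `θ` on a manifold `N` without boundary,
computed in the preferred chart at `x`, with the convention
`dθ(U, W) = U (θ W) - W (θ U) - θ [U, W]`. -/
def oneFormExtDeriv (I' : ModelWithCorners ℝ E' H') (θ : (x : N) → TangentSpace I' x →L[ℝ] ℝ)
    (x : N) (u w : TangentSpace I' x) : ℝ :=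
  extDeriv (oneFormInChart I' θ x) (extChartAt I' x x)
    ![mfderiv I' 𝓘(ℝ, E') (extChartAt I' x) x u, mfderiv I' 𝓘(ℝ, E') (extChartAt I' x) x w]

end ExteriorDerivative

section Finsler

variable {E : Type*} [NormedAddCommGroup E] [NormedSpace ℝ E]
  {Q : Type*} [TopologicalSpace Q] [ChartedSpace E Q]

/-- The restriction of a function on `TQ` to the tangent space at `q`. -/
def fibreRestrict (F : TangentBundle 𝓘(ℝ, E) Q → ℝ) (q : Q) (v : TangentSpace 𝓘(ℝ, E) q) : ℝ :=
  F ⟨q, v⟩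

variable [IsManifold 𝓘(ℝ, E) ∞ Q]

/-- A (not necessarily reversible) Finsler metric on `Q`. -/
structure IsFinslerMetric (F : TangentBundle 𝓘(ℝ, E) Q → ℝ) : Prop where
  nonneg : ∀ x, 0 ≤ F x
  /-- `G = F² / 2` is smooth outside the zero section. -/
  smooth : ContMDiffOn 𝓘(ℝ, E).tangent 𝓘(ℝ, ℝ) ∞
    (fun x : TangentBundle 𝓘(ℝ, E) Q => F x ^ 2 / 2) {x | x.snd ≠ 0}
  eq_zero_iff : ∀ (q : Q) (v : TangentSpace 𝓘(ℝ, E) q), F ⟨q, v⟩ = 0 ↔ v = 0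
  homogeneous : ∀ (q : Q) (v : TangentSpace 𝓘(ℝ, E) q) (ρ : ℝ), 0 < ρ →
    F ⟨q, ρ • v⟩ = ρ * F ⟨q, v⟩
  /-- The Hessian of `G = F² / 2` along each fibre is positive definite outside the origin. -/
  convex : ∀ (q : Q) (v : TangentSpace 𝓘(ℝ, E) q), v ≠ 0 →
    ∀ w : TangentSpace 𝓘(ℝ, E) q, w ≠ 0 →
      0 < fderiv ℝ (fderiv ℝ (fibreRestrict (fun x => F x ^ 2 / 2) q)) v w w

/-- The Hilbert form `β = (∂F/∂vⁱ) dqⁱ` on `TQ`, without coordinates: at `x = (q, v)` it sends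
`ξ` to the derivative of `F` along the fibre over `q`, at `v`, in the direction `dπ(ξ)`. -/
def hilbertForm (F : TangentBundle 𝓘(ℝ, E) Q → ℝ) (x : TangentBundle 𝓘(ℝ, E) Q) :
    TangentSpace 𝓘(ℝ, E).tangent x →L[ℝ] ℝ :=
  (fderiv ℝ (fibreRestrict F x.proj) x.snd).comp
    (mfderiv 𝓘(ℝ, E).tangent 𝓘(ℝ, E)
      (fun y : TangentBundle 𝓘(ℝ, E) Q => y.proj) x)

/-- The form `α = F β`. -/
def finslerForm (F : TangentBundle 𝓘(ℝ, E) Q → ℝ) (x : TangentBundle 𝓘(ℝ, E) Q) :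
    TangentSpace 𝓘(ℝ, E).tangent x →L[ℝ] ℝ :=
  F x • hilbertForm F x

/-- The unit tangent bundle `M = F⁻¹(1)`. -/
def unitBundle (F : TangentBundle 𝓘(ℝ, E) Q → ℝ) : Set (TangentBundle 𝓘(ℝ, E) Q) :=
  {x | F x = 1}

/-- The tangent space `T_x M = ker d_x F` of the regular level set `M = F⁻¹(1)`. -/
def unitBundleTangent (F : TangentBundle 𝓘(ℝ, E) Q → ℝ) (x : TangentBundle 𝓘(ℝ, E) Q) :
    Set (TangentSpace 𝓘(ℝ, E).tangent x) :=
  {ξ | mfderiv 𝓘(ℝ, E).tangent 𝓘(ℝ, ℝ) F x ξ = 0}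

/-- The restriction of `α` to `M` is a contact form: at each point of `M` it is non-zero on the
tangent space of `M`, and `dα` is non-degenerate on the hyperplane `ker α ∩ TM`. -/
def IsContactOnUnitBundle (F : TangentBundle 𝓘(ℝ, E) Q → ℝ) : Prop :=
  ∀ x ∈ unitBundle F,
    (∃ ξ ∈ unitBundleTangent F x, finslerForm F x ξ ≠ 0) ∧
    ∀ ξ ∈ unitBundleTangent F x, finslerForm F x ξ = 0 →
      (∀ η ∈ unitBundleTangent F x, finslerForm F x η = 0 →
        oneFormExtDeriv 𝓘(ℝ, E).tangent (finslerForm F) x ξ η = 0) →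
      ξ = 0

/-- `r` satisfies the defining equations of the value at `x ∈ M` of the Reeb vector field of
`α|_M`: it is tangent to `M`, `α(r) = 1`, and `dα(r, ·)` vanishes on the tangent space of `M`. -/
structure IsReebVector (F : TangentBundle 𝓘(ℝ, E) Q → ℝ) (x : TangentBundle 𝓘(ℝ, E) Q)
    (r : TangentSpace 𝓘(ℝ, E).tangent x) : Prop where
  tangent : r ∈ unitBundleTangent F x
  normalized : finslerForm F x r = 1
  interior_eq_zero : ∀ η ∈ unitBundleTangent F x,
    oneFormExtDeriv 𝓘(ℝ, E).tangent (finslerForm F) x r η = 0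

/-- The vector field `R`, whose values off `M` are irrelevant, is on `M` the Reeb vector field
of `α|_M`. -/
def IsReebVectorField (F : TangentBundle 𝓘(ℝ, E) Q → ℝ)
    (R : (x : TangentBundle 𝓘(ℝ, E) Q) → TangentSpace 𝓘(ℝ, E).tangent x) : Prop :=
  ∀ x ∈ unitBundle F, IsReebVector F x (R x)

/-- The curve `(γ, γ')` in `TQ` of a curve `γ : J → Q`. -/
def velocityLift (γ : ℝ → Q) (J : Set ℝ) (t : ℝ) : TangentBundle 𝓘(ℝ, E) Q :=
  ⟨γ t, mfderivWithin 𝓘(ℝ, ℝ) 𝓘(ℝ, E) γ J t (1 : ℝ)⟩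

/-- The length of the curve `γ : [a, b] → Q` with respect to `F`. -/
def finslerLength (F : TangentBundle 𝓘(ℝ, E) Q → ℝ) (γ : ℝ → Q) (a b : ℝ) : ℝ :=
  ∫ t in a..b, F (velocityLift γ (Icc a b) t)

/-- `c s t`, for `s ∈ (-ε, ε)` and `t ∈ [a, b]`, is a smooth variation of `γ : [a, b] → Q` that
is fixed near the end points. -/
structure IsVariation (γ : ℝ → Q) (a b : ℝ) (ε : ℝ) (c : ℝ → ℝ → Q) : Prop where
  pos : 0 < ε
  smooth : ContMDiffOn 𝓘(ℝ, ℝ × ℝ) 𝓘(ℝ, E) ∞ (fun p : ℝ × ℝ => c p.1 p.2)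
    (Ioo (-ε) ε ×ˢ Icc a b)
  zero : ∀ t ∈ Icc a b, c 0 t = γ t
  fixed : ∃ δ > 0, ∀ s ∈ Ioo (-ε) ε, ∀ t ∈ Icc a b, t < a + δ ∨ b - δ < t → c s t = γ t

/-- `γ : J → Q` (with `J` an interval) is a unit speed geodesic: it is smooth, of unit speed, and
on each compact subinterval it is a critical point of the length functional. -/
structure IsUnitSpeedGeodesic (F : TangentBundle 𝓘(ℝ, E) Q → ℝ) (γ : ℝ → Q) (J : Set ℝ) :
    Prop where
  smooth : ContMDiffOn 𝓘(ℝ, ℝ) 𝓘(ℝ, E) ∞ γ J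
  unit_speed : ∀ t ∈ J, F (velocityLift γ J t) = 1
  critical : ∀ a b : ℝ, a < b → Icc a b ⊆ J →
    ∀ (ε : ℝ) (c : ℝ → ℝ → Q), IsVariation (E := E) γ a b ε c →
      HasDerivAt (fun s => finslerLength F (c s) a b) 0 0

end Finsler

end

/-!
The proof reads every object in the charts of `TQ` induced by charts of `Q`. There the form
`α = F β` is `(∂G/∂vⁱ) dpⁱ` with `G = F² / 2`, so that `dα` is a combination of second derivatives
of `G`, and Euler's identities for the `2`-homogeneous function `G` together with the positivity of
its fibrewise Hessian do all the work.

* Contact condition (`IsLocalFinsler.eq_zero_of_localExtDeriv_eq_zero`): if `(ξ, η)` in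
  `ker α ∩ TM` pairs to zero with `ker α ∩ TM`, pairing with `(0, ξ)` gives `G_vv (ξ, ξ) = 0`, thus
  `ξ = 0`, and pairing with a suitable `(η, η')` gives `G_vv (η, η) = 0`, thus `η = 0`.
* Reeb vector (`IsLocalFinsler.isLocalReeb_iff`): the vector `(v, w)` with
  `G_pv (v; ·) + G_vv (w, ·) = G_p` satisfies `dα ((v, w), ·) = -dG`, which vanishes on `TM`. It is
  therefore the Reeb vector, and is unique by the contact condition. The equation for `w` is the
  geodesic equation, and its solution depends smoothly on `(p, v)`. That the exterior derivative
  may be computed in any chart (`oneFormExtDeriv_eq_extDeriv`) makes this available in a fixed chart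
  along a curve (`isReebVector_iff_geodesicAcceleration`).
* Orbits are geodesics (`isUnitSpeedGeodesic_of_isMIntegralCurveOn`): an integral curve of `R` is
  smooth since the spray is, it is the velocity curve of its projection, and it satisfies the
  Euler-Lagrange equation of `F`, since `dG = dF` along curves in `M`. Under a variation, the
  derivative of the speed is then the time derivative of the globally defined function
  `(∂F/∂v) (∂c/∂s)`, which vanishes at the end points.
* Geodesics are orbits (`IsUnitSpeedGeodesic.isMIntegralCurveOn`): at interior times, variations
  supported in one chart and the du Bois-Reymond lemma give the Euler-Lagrange equation, which for
  unit speed curves is the geodesic equation. It extends to the end points by continuity.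
-/

/-! ### Finsler functions on an open subset of a vector space -/

section Local

variable {E : Type*} [NormedAddCommGroup E] [NormedSpace ℝ E]

/-- The energy `G = L² / 2` of a function `L` on `E × E`. -/
noncomputable def localEnergy (L : E × E → ℝ) (y : E × E) : ℝ := L y ^ 2 / 2

/-- `L (p, v)` is a Finsler metric on the open subset `V` of the vector space `E`, whose tangent
bundle is `V × E`. -/
structure IsLocalFinsler (V : Set E) (L : E × E → ℝ) : Prop where
  isOpen : IsOpen V
  smooth : ContDiffOn ℝ ∞ (localEnergy L) {y | y.1 ∈ V ∧ y.2 ≠ 0}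
  pos : ∀ p ∈ V, ∀ v ≠ 0, 0 < L (p, v)
  homogeneous : ∀ p ∈ V, ∀ v : E, ∀ ρ : ℝ, 0 < ρ → L (p, ρ • v) = ρ * L (p, v)
  convex : ∀ p ∈ V, ∀ v ≠ 0, ∀ w ≠ 0,
    0 < fderiv ℝ (fderiv ℝ (localEnergy L)) (p, v) (0, w) (0, w)

namespace IsLocalFinsler

variable {V : Set E} {L : E × E → ℝ} (h : IsLocalFinsler V L) {y : E × E}
include h

theorem isOpen_slit : IsOpen {y : E × E | y.1 ∈ V ∧ y.2 ≠ 0} :=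
  (h.isOpen.preimage continuous_fst).inter (isOpen_ne.preimage continuous_snd)

theorem contDiffAt_energy (hp : y.1 ∈ V) (hv : y.2 ≠ 0) :
    ContDiffAt ℝ ∞ (localEnergy L) y :=
  h.smooth.contDiffAt (h.isOpen_slit.mem_nhds ⟨hp, hv⟩)

theorem contDiffAt (hp : y.1 ∈ V) (hv : y.2 ≠ 0) : ContDiffAt ℝ ∞ L y := by
  have hpos : 0 < L y := h.pos y.1 hp y.2 hv
  have h1 : ContDiffAt ℝ ∞ (fun z => Real.sqrt (2 * localEnergy L z)) y := by
    refine ContDiffAt.sqrt (contDiffAt_const.mul (h.contDiffAt_energy hp hv)) ?_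
    simp only [localEnergy]; positivity
  refine h1.congr_of_eventuallyEq ?_
  filter_upwards [h.isOpen_slit.mem_nhds ⟨hp, hv⟩] with z hz
  have : 2 * localEnergy L z = L z ^ 2 := by simp only [localEnergy]; ring
  rw [this, Real.sqrt_sq (h.pos z.1 hz.1 z.2 hz.2).le]

theorem differentiableAt (hp : y.1 ∈ V) (hv : y.2 ≠ 0) : DifferentiableAt ℝ L y :=
  (h.contDiffAt hp hv).differentiableAt (by simp)

theorem differentiableAt_energy (hp : y.1 ∈ V) (hv : y.2 ≠ 0) :
    DifferentiableAt ℝ (localEnergy L) y :=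
  (h.contDiffAt_energy hp hv).differentiableAt (by simp)

theorem contDiffAt_fderiv_energy (hp : y.1 ∈ V) (hv : y.2 ≠ 0) :
    ContDiffAt ℝ ∞ (fderiv ℝ (localEnergy L)) y :=
  (h.contDiffAt_energy hp hv).fderiv_right (by simp)

theorem differentiableAt_fderiv_energy (hp : y.1 ∈ V) (hv : y.2 ≠ 0) :
    DifferentiableAt ℝ (fderiv ℝ (localEnergy L)) y :=
  (h.contDiffAt_fderiv_energy hp hv).differentiableAt (by simp)

theorem fderiv_energy (hp : y.1 ∈ V) (hv : y.2 ≠ 0) :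
    fderiv ℝ (localEnergy L) y = L y • fderiv ℝ L y := by
  have h1 := (((h.differentiableAt hp hv).hasFDerivAt.pow 2).mul_const (2⁻¹ : ℝ)).fderiv
  have h2 : localEnergy L = fun z => (L ^ 2) z * 2⁻¹ := by
    ext z; simp [localEnergy, div_eq_mul_inv]
  rw [h2]
  refine h1.trans ?_
  ext z <;> simp <;> ring

theorem symm (hp : y.1 ∈ V) (hv : y.2 ≠ 0) (a b : E × E) :
    fderiv ℝ (fderiv ℝ (localEnergy L)) y a b = fderiv ℝ (fderiv ℝ (localEnergy L)) y b a :=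
  ((h.contDiffAt_energy hp hv).isSymmSndFDerivAt
    (by rw [minSmoothness_of_isRCLikeNormedField]; exact ENat.LEInfty.out)).eq a b

/-- Euler's identity for the energy, which is homogeneous of degree `2` on the fibres. -/
theorem fderiv_energy_vertical (hp : y.1 ∈ V) (hv : y.2 ≠ 0) :
    fderiv ℝ (localEnergy L) y (0, y.2) = 2 * localEnergy L y := by
  have h1 : HasDerivAt (fun ρ : ℝ => ((y.1, ρ • y.2) : E × E)) (0, y.2) 1 := by
    have := (hasDerivAt_id (1 : ℝ)).smul_const y.2
    simpa using (hasDerivAt_const (1 : ℝ) y.1).prodMk this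
  have hy : y = (y.1, (1 : ℝ) • y.2) := by simp
  have h2 : HasDerivAt (fun ρ : ℝ => localEnergy L (y.1, ρ • y.2))
      (fderiv ℝ (localEnergy L) y (0, y.2)) 1 := by
    have h3 := (h.differentiableAt_energy hp hv).hasFDerivAt
    refine HasFDerivAt.comp_hasDerivAt (f := fun ρ : ℝ => ((y.1, ρ • y.2) : E × E))
      (l := localEnergy L) (1 : ℝ) ?_ h1
    simpa using h3
  have h4 : HasDerivAt (fun ρ : ℝ => ρ ^ 2 * localEnergy L y) (2 * localEnergy L y) 1 := by
    simpa using (hasDerivAt_pow 2 (1 : ℝ)).mul_const (localEnergy L y)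
  refine h2.unique (h4.congr_of_eventuallyEq ?_)
  filter_upwards [lt_mem_nhds (zero_lt_one' ℝ)] with ρ hρ
  simp only [localEnergy]
  rw [h.homogeneous y.1 hp y.2 ρ hρ]
  ring

/-- The derivative of Euler's identity. -/
theorem fderiv_fderiv_energy_vertical (hp : y.1 ∈ V) (hv : y.2 ≠ 0) (z : E × E) :
    fderiv ℝ (fderiv ℝ (localEnergy L)) y z (0, y.2) =
      2 * fderiv ℝ (localEnergy L) y z - fderiv ℝ (localEnergy L) y (0, z.2) := by
  have h1 := (h.differentiableAt_fderiv_energy hp hv).hasFDerivAt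
  have h2 : HasFDerivAt (fun y : E × E => ((0, y.2) : E × E))
      ((ContinuousLinearMap.inr ℝ E E).comp (ContinuousLinearMap.snd ℝ E E)) y :=
    ((ContinuousLinearMap.inr ℝ E E).comp (ContinuousLinearMap.snd ℝ E E)).hasFDerivAt
  have h3 := h1.clm_apply h2
  have h4 := (h.differentiableAt_energy hp hv).hasFDerivAt.const_mul 2
  have h5 := h3.unique (h4.congr_of_eventuallyEq (by
    filter_upwards [h.isOpen_slit.mem_nhds ⟨hp, hv⟩] with z hz
    exact h.fderiv_energy_vertical hz.1 hz.2))
  have h6 := congrArg (fun l : E × E →L[ℝ] ℝ => l z) h5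
  simp at h6
  linarith

end IsLocalFinsler
end Local

/-! ### The contact condition and the Reeb vector in coordinates -/

section Local

variable {E : Type*} [NormedAddCommGroup E] [NormedSpace ℝ E]

/-- The exterior derivative at `y` of the `1`-form `(∂G/∂vⁱ) dpⁱ`, where `G = L² / 2`, in terms of
the second derivative of `G`. -/
noncomputable def localExtDeriv (L : E × E → ℝ) (y a b : E × E) : ℝ :=
  fderiv ℝ (fderiv ℝ (localEnergy L)) y a (0, b.1) -
    fderiv ℝ (fderiv ℝ (localEnergy L)) y b (0, a.1)

/-- The equations of the Reeb vector at `y` of `(∂G/∂vⁱ) dpⁱ`, restricted to `{L = 1}`. -/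
structure IsLocalReeb (L : E × E → ℝ) (y r : E × E) : Prop where
  tangent : fderiv ℝ (localEnergy L) y r = 0
  normalized : fderiv ℝ (localEnergy L) y (0, r.1) = 1
  interior_eq_zero : ∀ z, fderiv ℝ (localEnergy L) y z = 0 → localExtDeriv L y r z = 0

/-- The Hessian of `G = L² / 2` along the fibre. -/
noncomputable def verticalHessian (L : E × E → ℝ) (y : E × E) : E →L[ℝ] E →L[ℝ] ℝ :=
  ((ContinuousLinearMap.compL ℝ E (E × E) ℝ).flip (ContinuousLinearMap.inr ℝ E E)).comp
    ((fderiv ℝ (fderiv ℝ (localEnergy L)) y).comp (ContinuousLinearMap.inr ℝ E E))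

/-- The acceleration of the geodesic of `L` with initial position and velocity `y`: the
solution `w` of `∂²G/∂v∂v (w, ·) = ∂G/∂p - ∂²G/∂p∂v (v, ·)`, where `y = (p, v)`. -/
noncomputable def geodesicAcceleration (L : E × E → ℝ) (y : E × E) : E :=
  (verticalHessian L y).inverse
    ((fderiv ℝ (localEnergy L) y).comp (ContinuousLinearMap.inl ℝ E E) -
      (fderiv ℝ (fderiv ℝ (localEnergy L)) y (y.2, 0)).comp (ContinuousLinearMap.inr ℝ E E))

@[simp]
theorem verticalHessian_apply (L : E × E → ℝ) (y : E × E) (a b : E) :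
    verticalHessian L y a b = fderiv ℝ (fderiv ℝ (localEnergy L)) y (0, a) (0, b) := rfl

namespace IsLocalFinsler

variable {V : Set E} {L : E × E → ℝ} (h : IsLocalFinsler V L) {y : E × E}
include h

/-- The contact condition, in coordinates. Pairing `z` with `(0, z.1)` shows that the horizontal
part of `z` vanishes, by convexity along the fibre; pairing it with a vector whose horizontal part
is the vertical part of `z` then shows that `z = 0`. -/
theorem eq_zero_of_localExtDeriv_eq_zero (hp : y.1 ∈ V) (hv : y.2 ≠ 0) (hL : L y = 1)
    {z : E × E} (hz : fderiv ℝ (localEnergy L) y z = 0)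
    (hz' : fderiv ℝ (localEnergy L) y (0, z.1) = 0)
    (hker : ∀ b, fderiv ℝ (localEnergy L) y b = 0 → fderiv ℝ (localEnergy L) y (0, b.1) = 0 →
      localExtDeriv L y z b = 0) : z = 0 := by
  have h0 : ((0 : E), (0 : E)) = 0 := rfl
  have hz1 : z.1 = 0 := by
    by_contra hne
    have h1 := hker (0, z.1) hz' (by rw [h0, map_zero])
    have h2 := h.convex y.1 hp y.2 hv z.1 hne
    simp only [localExtDeriv, h0, map_zero] at h1
    simp only [Prod.mk.eta] at h2
    linarith
  obtain ⟨z1, η⟩ := z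
  obtain rfl : z1 = 0 := hz1
  have hη : η = 0 := by
    by_contra hne
    have hE := h.fderiv_energy_vertical hp hv
    -- `η` is a horizontal direction in `ker α`; a multiple of the Euler vector field corrects it
    -- to a vector tangent to the level set of `L`.
    have h1 := hker (η, -(fderiv ℝ (localEnergy L) y (η, 0)) • y.2) (by
      have : ((η, -(fderiv ℝ (localEnergy L) y (η, 0)) • y.2) : E × E) =
          (η, 0) + (-(fderiv ℝ (localEnergy L) y (η, 0))) • (0, y.2) := by simp
      rw [this, map_add, map_smul, hE, localEnergy, hL]
      simp) hz
    have h2 := h.convex y.1 hp y.2 hv η hne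
    simp only [localExtDeriv, h0, map_zero] at h1
    simp only [Prod.mk.eta] at h2
    linarith
  rw [hη, h0]

theorem localReeb_unique (hp : y.1 ∈ V) (hv : y.2 ≠ 0) (hL : L y = 1) {r r' : E × E}
    (hr : IsLocalReeb L y r) (hr' : IsLocalReeb L y r') : r = r' := by
  rw [← sub_eq_zero]
  have h1 : ((0, (r - r').1) : E × E) = (0, r.1) - (0, r'.1) := by simp
  refine h.eq_zero_of_localExtDeriv_eq_zero hp hv hL ?_ ?_ ?_
  · rw [map_sub, hr.tangent, hr'.tangent, sub_zero]
  · rw [h1, map_sub, hr.normalized, hr'.normalized, sub_self]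
  · intro b hb _
    have h2 := hr.interior_eq_zero b hb
    have h3 := hr'.interior_eq_zero b hb
    simp only [localExtDeriv] at h2 h3 ⊢
    rw [h1, map_sub, map_sub, sub_apply]
    linarith

/-- A solution of the geodesic equation at one point gives the Reeb vector: by Euler's identities
it satisfies `dα (r, ·) = -dG`, also in directions that are not tangent to the level set. -/
theorem isLocalReeb_of_geodesic_eq (hp : y.1 ∈ V) (hv : y.2 ≠ 0) (hL : L y = 1) {w : E}
    (hw : ∀ ξ, fderiv ℝ (fderiv ℝ (localEnergy L)) y (y.2, w) (0, ξ) =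
      fderiv ℝ (localEnergy L) y (ξ, 0)) : IsLocalReeb L y (y.2, w) := by
  have split (a b : E) : fderiv ℝ (localEnergy L) y (a, b) =
      fderiv ℝ (localEnergy L) y (a, 0) + fderiv ℝ (localEnergy L) y (0, b) := by
    rw [← map_add]; simp
  refine ⟨?_, ?_, ?_⟩
  · have h1 := hw y.2
    rw [h.fderiv_fderiv_energy_vertical hp hv] at h1
    rw [split] at h1 ⊢
    linarith
  · rw [h.fderiv_energy_vertical hp hv, localEnergy, hL]; norm_num
  · rintro ⟨ξ, η⟩ hz
    simp only [localExtDeriv]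
    rw [hw, h.fderiv_fderiv_energy_vertical hp hv, hz]
    rw [split] at hz
    linarith

variable [FiniteDimensional ℝ E]

/-- The fibrewise Hessian is positive definite, hence injective, hence invertible in finite
dimension. -/
theorem isInvertible_verticalHessian (hp : y.1 ∈ V) (hv : y.2 ≠ 0) :
    (verticalHessian L y).IsInvertible := by
  have hinj : Function.Injective (verticalHessian L y) := by
    rw [injective_iff_map_eq_zero]
    intro w hw
    by_contra hne
    have h1 := h.convex y.1 hp y.2 hv w hne
    rw [Prod.mk.eta, ← verticalHessian_apply, hw] at h1
    simp at h1
  have hfin : Module.finrank ℝ E = Module.finrank ℝ (E →L[ℝ] ℝ) := by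
    rw [← Subspace.dual_finrank_eq (K := ℝ) (V := E)]
    exact (LinearMap.toContinuousLinearMap (𝕜 := ℝ) (E := E) (F' := ℝ)).finrank_eq
  refine ⟨(LinearEquiv.ofInjectiveOfFinrankEq (verticalHessian L y : E →ₗ[ℝ] E →L[ℝ] ℝ)
    hinj hfin).toContinuousLinearEquiv, ?_⟩
  ext a b
  rfl

theorem geodesicAcceleration_eq_iff (hp : y.1 ∈ V) (hv : y.2 ≠ 0) (w : E) :
    w = geodesicAcceleration L y ↔
      ∀ ξ, fderiv ℝ (fderiv ℝ (localEnergy L)) y (y.2, w) (0, ξ) =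
        fderiv ℝ (localEnergy L) y (ξ, 0) := by
  obtain ⟨e, he⟩ := h.isInvertible_verticalHessian hp hv
  have hsplit (ξ : E) : fderiv ℝ (fderiv ℝ (localEnergy L)) y (y.2, w) (0, ξ) =
      fderiv ℝ (fderiv ℝ (localEnergy L)) y (y.2, 0) (0, ξ) + e w ξ := by
    have : e w ξ = verticalHessian L y w ξ := by rw [← he]; rfl
    rw [this, verticalHessian_apply, ← add_apply, ← map_add]
    simp
  rw [geodesicAcceleration, ← he, ContinuousLinearMap.inverse_equiv, ContinuousLinearEquiv.coe_coe,
    ContinuousLinearEquiv.eq_symm_apply, ContinuousLinearMap.ext_iff]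
  refine forall_congr' fun ξ => ?_
  rw [hsplit]
  simp only [sub_apply, ContinuousLinearMap.comp_apply,
    ContinuousLinearMap.inl_apply, ContinuousLinearMap.inr_apply]
  constructor <;> intro h' <;> linarith

theorem isLocalReeb_geodesicAcceleration (hp : y.1 ∈ V) (hv : y.2 ≠ 0) (hL : L y = 1) :
    IsLocalReeb L y (y.2, geodesicAcceleration L y) :=
  h.isLocalReeb_of_geodesic_eq hp hv hL ((h.geodesicAcceleration_eq_iff hp hv _).1 rfl)

/-- The Reeb equations at `y` have exactly one solution, the geodesic spray at `y`. -/
theorem isLocalReeb_iff (hp : y.1 ∈ V) (hv : y.2 ≠ 0) (hL : L y = 1) {r : E × E} :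
    IsLocalReeb L y r ↔ r = (y.2, geodesicAcceleration L y) :=
  ⟨fun hr => h.localReeb_unique hp hv hL hr (h.isLocalReeb_geodesicAcceleration hp hv hL),
    fun hr => hr ▸ h.isLocalReeb_geodesicAcceleration hp hv hL⟩

theorem contDiffAt_geodesicAcceleration (hp : y.1 ∈ V) (hv : y.2 ≠ 0) :
    ContDiffAt ℝ ∞ (geodesicAcceleration L) y := by
  have hB : ContDiffAt ℝ ∞ (fderiv ℝ (fderiv ℝ (localEnergy L))) y :=
    (h.contDiffAt_fderiv_energy hp hv).fderiv_right (by simp)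
  have hH : ContDiffAt ℝ ∞ (verticalHessian L) y :=
    contDiffAt_const.clm_comp (hB.clm_comp contDiffAt_const)
  have hinv : ContDiffAt ℝ ∞ (fun y => (verticalHessian L y).inverse) y := by
    obtain ⟨e, he⟩ := h.isInvertible_verticalHessian hp hv
    have hi := contDiffAt_map_inverse (𝕜 := ℝ) (n := ∞) e
    rw [he] at hi
    exact hi.comp y hH
  refine hinv.clm_apply (ContDiffAt.sub ?_ ?_)
  · exact (h.contDiffAt_fderiv_energy hp hv).clm_comp contDiffAt_const
  · refine ContDiffAt.clm_comp (hB.clm_apply ?_) contDiffAt_const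
    exact contDiffAt_snd.prodMk contDiffAt_const

end IsLocalFinsler
end Local

/-! ### Derivatives along the fibres -/

section FibreDerivatives

variable {E : Type*} [NormedAddCommGroup E] [NormedSpace ℝ E]

theorem hasFDerivAt_prodMk_clm (p : E) (B : E →L[ℝ] E) (u : E) :
    HasFDerivAt (fun u => ((p, B u) : E × E)) ((ContinuousLinearMap.inr ℝ E E).comp B) u := by
  have h := (hasFDerivAt_const p u).prodMk B.hasFDerivAt
  refine h.congr_fderiv ?_
  ext a <;> simp

theorem fderiv_comp_prodMk_clm {G : E × E → ℝ} {p : E} {B : E →L[ℝ] E} {u : E}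
    (hG : DifferentiableAt ℝ G (p, B u)) :
    fderiv ℝ (fun u => G (p, B u)) u =
      (fderiv ℝ G (p, B u)).comp ((ContinuousLinearMap.inr ℝ E E).comp B) :=
  (hG.hasFDerivAt.comp u (hasFDerivAt_prodMk_clm p B u)).fderiv

theorem fderiv_fderiv_comp_prodMk_clm {G : E × E → ℝ} {p : E} {B : E →L[ℝ] E} {u : E}
    (hG : ContDiffAt ℝ ∞ G (p, B u)) (a b : E) :
    fderiv ℝ (fderiv ℝ (fun u => G (p, B u))) u a b =
      fderiv ℝ (fderiv ℝ G) (p, B u) (0, B a) (0, B b) := by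
  have hι := hasFDerivAt_prodMk_clm p B u
  have hd : ∀ᶠ z in 𝓝 (p, B u), DifferentiableAt ℝ G z := by
    filter_upwards [(hG.of_le (m := 1) ENat.LEInfty.out).eventually (by simp)] with z hz
    exact hz.differentiableAt (by simp)
  have h1 : fderiv ℝ (fun u => G (p, B u)) =ᶠ[𝓝 u] fun u =>
      (fderiv ℝ G (p, B u)).comp ((ContinuousLinearMap.inr ℝ E E).comp B) := by
    filter_upwards [hι.continuousAt.eventually hd] with z hz
    exact fderiv_comp_prodMk_clm hz
  have h2 : HasFDerivAt (fderiv ℝ G) (fderiv ℝ (fderiv ℝ G) (p, B u)) (p, B u) :=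
    ((hG.fderiv_right (m := ∞) (by simp)).differentiableAt (by simp)).hasFDerivAt
  have h3 := (h2.comp u hι).clm_comp
    (hasFDerivAt_const ((ContinuousLinearMap.inr ℝ E E).comp B) u)
  have h4 := (h3.congr_of_eventuallyEq h1).fderiv
  rw [h4]
  simp

end FibreDerivatives

/-! ### Finsler metrics in the charts of the tangent bundle -/

section Chart

variable {E : Type*} [NormedAddCommGroup E] [NormedSpace ℝ E]
  {Q : Type*} [TopologicalSpace Q] [ChartedSpace E Q] [IsManifold 𝓘(ℝ, E) ∞ Q]

theorem mem_extChartAt_tangent_source {x₀ x : TangentBundle 𝓘(ℝ, E) Q} :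
    x ∈ (extChartAt 𝓘(ℝ, E).tangent x₀).source ↔ x.proj ∈ (chartAt E x₀.proj).source := by
  rw [extChartAt_source, TangentBundle.mem_chart_source_iff]

theorem mem_extChartAt_tangent_target {x₀ : TangentBundle 𝓘(ℝ, E) Q} {y : E × E} :
    y ∈ (extChartAt 𝓘(ℝ, E).tangent x₀).target ↔ y.1 ∈ (extChartAt 𝓘(ℝ, E) x₀.proj).target := by
  have h := TangentBundle.mem_chart_target_iff (I := 𝓘(ℝ, E)) y x₀
  simp only [extChartAt_target, ModelWithCorners.Boundaryless.range_eq_univ, inter_univ,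
    mem_preimage]
  exact h

/-- The charts of `TQ` are the tangent maps of the charts of `Q`. -/
theorem extChartAt_tangent_apply {x₀ x : TangentBundle 𝓘(ℝ, E) Q}
    (hx : x.proj ∈ (chartAt E x₀.proj).source) :
    extChartAt 𝓘(ℝ, E).tangent x₀ x =
      (extChartAt 𝓘(ℝ, E) x₀.proj x.proj,
        mfderiv 𝓘(ℝ, E) 𝓘(ℝ, E) (extChartAt 𝓘(ℝ, E) x₀.proj) x.proj x.snd) := by
  rw [← TangentBundle.continuousLinearMapAt_trivializationAt hx,
    TangentBundle.continuousLinearMapAt_trivializationAt_eq_core hx]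
  rfl

variable {F : TangentBundle 𝓘(ℝ, E) Q → ℝ}

/-- A function on `TQ` in the chart of `TQ` induced by the preferred chart of `Q` at the base
point of `x₀`. -/
noncomputable def localMetric (F : TangentBundle 𝓘(ℝ, E) Q → ℝ) (x₀ : TangentBundle 𝓘(ℝ, E) Q)
    (y : E × E) : ℝ :=
  F ((extChartAt 𝓘(ℝ, E).tangent x₀).symm y)

theorem localMetric_extChartAt {x₀ x : TangentBundle 𝓘(ℝ, E) Q}
    (hx : x.proj ∈ (chartAt E x₀.proj).source) :
    localMetric F x₀ (extChartAt 𝓘(ℝ, E).tangent x₀ x) = F x := by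
  rw [localMetric, (extChartAt _ x₀).left_inv (mem_extChartAt_tangent_source.2 hx)]

theorem fibreRestrict_eq (x₀ : TangentBundle 𝓘(ℝ, E) Q) {q : Q}
    (hq : q ∈ (chartAt E x₀.proj).source) :
    fibreRestrict F q = fun u => localMetric F x₀ (extChartAt 𝓘(ℝ, E) x₀.proj q,
        mfderiv 𝓘(ℝ, E) 𝓘(ℝ, E) (extChartAt 𝓘(ℝ, E) x₀.proj) q u) := by
  ext u
  have h := localMetric_extChartAt (F := F) (x₀ := x₀) (x := ⟨q, u⟩) hq
  rw [extChartAt_tangent_apply (x := ⟨q, u⟩) hq] at h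
  exact h.symm

theorem extChartAt_tangent_snd_ne_zero {x₀ x : TangentBundle 𝓘(ℝ, E) Q}
    (hx : x.proj ∈ (chartAt E x₀.proj).source) :
    (extChartAt 𝓘(ℝ, E).tangent x₀ x).2 ≠ 0 ↔ x.snd ≠ 0 := by
  rw [extChartAt_tangent_apply hx]
  have h := isInvertible_mfderiv_extChartAt (I := 𝓘(ℝ, E)) (x := x₀.proj) (y := x.proj)
    (by rwa [extChartAt_source])
  exact (map_ne_zero_iff _ h.injective)

theorem contDiffOn_localEnergy (hF : IsFinslerMetric F) (x₀ : TangentBundle 𝓘(ℝ, E) Q) :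
    ContDiffOn ℝ ∞ (localEnergy (localMetric F x₀))
      {y | y.1 ∈ (extChartAt 𝓘(ℝ, E) x₀.proj).target ∧ y.2 ≠ 0} := by
  rw [← contMDiffOn_iff_contDiffOn]
  have h := contMDiffOn_extChartAt_symm (I := 𝓘(ℝ, E).tangent) (n := ∞) x₀
  refine ContMDiffOn.comp (hF.smooth) (h.mono fun y hy => mem_extChartAt_tangent_target.2 hy.1) ?_
  rintro y ⟨hy, hv⟩
  have hy' : y ∈ (extChartAt 𝓘(ℝ, E).tangent x₀).target := mem_extChartAt_tangent_target.2 hy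
  have hs := (extChartAt 𝓘(ℝ, E).tangent x₀).map_target hy'
  have := extChartAt_tangent_snd_ne_zero (mem_extChartAt_tangent_source.1 hs)
  rw [(extChartAt 𝓘(ℝ, E).tangent x₀).right_inv hy'] at this
  exact this.1 hv

/-- In a chart, a Finsler metric on `Q` is a Finsler metric on an open subset of `E`. -/
theorem isLocalFinsler_localMetric (hF : IsFinslerMetric F) (x₀ : TangentBundle 𝓘(ℝ, E) Q) :
    IsLocalFinsler (extChartAt 𝓘(ℝ, E) x₀.proj).target (localMetric F x₀) := by
  have key (p : E) (hp : p ∈ (extChartAt 𝓘(ℝ, E) x₀.proj).target) :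
      ∃ q ∈ (chartAt E x₀.proj).source, extChartAt 𝓘(ℝ, E) x₀.proj q = p ∧
        ∀ v : E, ∃ u : TangentSpace 𝓘(ℝ, E) q,
          mfderiv 𝓘(ℝ, E) 𝓘(ℝ, E) (extChartAt 𝓘(ℝ, E) x₀.proj) q u = v := by
    refine ⟨_, by simpa using (extChartAt 𝓘(ℝ, E) x₀.proj).map_target hp,
      (extChartAt 𝓘(ℝ, E) x₀.proj).right_inv hp, fun v => ?_⟩
    exact (isInvertible_mfderiv_extChartAt (I := 𝓘(ℝ, E)) (x := x₀.proj)
      ((extChartAt 𝓘(ℝ, E) x₀.proj).map_target hp)).surjective v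
  refine ⟨isOpen_extChartAt_target x₀.proj, contDiffOn_localEnergy hF x₀, ?_, ?_, ?_⟩
  · intro p hp v hv
    obtain ⟨q, hq, rfl, hsurj⟩ := key p hp
    obtain ⟨u, rfl⟩ := hsurj v
    have hu : u ≠ 0 := fun h0 => hv (by rw [h0]; exact map_zero _)
    have h1 := congrFun (fibreRestrict_eq (F := F) x₀ hq) u
    rw [← h1]
    exact (hF.nonneg _).lt_of_ne fun h0 => hu ((hF.eq_zero_iff q u).1 h0.symm)
  · intro p hp v ρ hρ
    obtain ⟨q, hq, rfl, hsurj⟩ := key p hp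
    obtain ⟨u, rfl⟩ := hsurj v
    have h1 := congrFun (fibreRestrict_eq (F := F) x₀ hq) u
    have h2 := congrFun (fibreRestrict_eq (F := F) x₀ hq) (ρ • u)
    have h3 := hF.homogeneous q u ρ hρ
    rw [map_smul] at h2
    exact (h2.symm.trans h3).trans (congrArg (ρ * ·) h1)
  · intro p hp v hv w hw
    obtain ⟨q, hq, rfl, hsurj⟩ := key p hp
    obtain ⟨u, rfl⟩ := hsurj v
    obtain ⟨u', rfl⟩ := hsurj w
    have hu : u ≠ 0 := fun h0 => hv (by rw [h0]; exact map_zero _)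
    have hu' : u' ≠ 0 := fun h0 => hw (by rw [h0]; exact map_zero _)
    have h1 := hF.convex q u hu u' hu'
    have h2 : fibreRestrict (fun x => F x ^ 2 / 2) q = fun u =>
        localEnergy (localMetric F x₀) (extChartAt 𝓘(ℝ, E) x₀.proj q,
          mfderiv 𝓘(ℝ, E) 𝓘(ℝ, E) (extChartAt 𝓘(ℝ, E) x₀.proj) q u) :=
      fibreRestrict_eq (F := fun x => F x ^ 2 / 2) x₀ hq
    rw [h2] at h1
    refine h1.trans_eq ?_
    refine fderiv_fderiv_comp_prodMk_clm (E := E)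
      (B := mfderiv 𝓘(ℝ, E) 𝓘(ℝ, E) (extChartAt 𝓘(ℝ, E) x₀.proj) q) ?_ u' u'
    refine (contDiffOn_localEnergy hF x₀).contDiffAt ?_
    exact (((isOpen_extChartAt_target x₀.proj).preimage continuous_fst).inter
      (isOpen_ne.preimage continuous_snd)).mem_nhds ⟨hp, hv⟩

/-- The fibre derivative of `F`, in a chart. -/
theorem fderiv_fibreRestrict (hF : IsFinslerMetric F) {x₀ x : TangentBundle 𝓘(ℝ, E) Q}
    (hx : x.proj ∈ (chartAt E x₀.proj).source) (hv : x.snd ≠ 0) (w : TangentSpace 𝓘(ℝ, E) x.proj) :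
    fderiv ℝ (fibreRestrict F x.proj) x.snd w =
      fderiv ℝ (localMetric F x₀) (extChartAt 𝓘(ℝ, E).tangent x₀ x)
        (0, mfderiv 𝓘(ℝ, E) 𝓘(ℝ, E) (extChartAt 𝓘(ℝ, E) x₀.proj) x.proj w) := by
  have h := (isLocalFinsler_localMetric hF x₀).differentiableAt
    (y := extChartAt 𝓘(ℝ, E).tangent x₀ x)
    (mem_extChartAt_tangent_target.1 ((extChartAt _ x₀).map_source
      (mem_extChartAt_tangent_source.2 hx))) ((extChartAt_tangent_snd_ne_zero hx).2 hv)
  rw [extChartAt_tangent_apply hx] at h ⊢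
  rw [fibreRestrict_eq x₀ hx]
  exact congrArg (fun l : E →L[ℝ] ℝ => l w) (fderiv_comp_prodMk_clm (E := E)
      (B := mfderiv 𝓘(ℝ, E) 𝓘(ℝ, E) (extChartAt 𝓘(ℝ, E) x₀.proj) x.proj) h)

end Chart

/-! ### The exterior derivative in an arbitrary chart -/

section OneForms

theorem differentiableAt_ofSubsingleton {W : Type*} [NormedAddCommGroup W] [NormedSpace ℝ W]
    {A : W → W →L[ℝ] ℝ} {y : W} (hA : DifferentiableAt ℝ A y) :
    DifferentiableAt ℝ (fun y =>
      ContinuousAlternatingMap.ofSubsingleton ℝ W ℝ (0 : Fin 1) (A y)) y :=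
  DifferentiableAt.comp y
    (g := fun l : W →L[ℝ] ℝ => ContinuousAlternatingMap.ofSubsingleton ℝ W ℝ (0 : Fin 1) l)
    (ContinuousAlternatingMap.ofSubsingletonLIE (𝕜 := ℝ) (E := W) (F := ℝ)
      (0 : Fin 1)).differentiableAt hA

theorem extDeriv_ofSubsingleton {W : Type*} [NormedAddCommGroup W] [NormedSpace ℝ W]
    {A : W → W →L[ℝ] ℝ} {y : W} (hA : DifferentiableAt ℝ A y) (a b : W) :
    extDeriv (fun y => ContinuousAlternatingMap.ofSubsingleton ℝ W ℝ (0 : Fin 1) (A y)) y ![a, b] =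
      fderiv ℝ A y a b - fderiv ℝ A y b a := by
  have h (c d : W) : fderiv ℝ (fun z => A z c) y d = fderiv ℝ A y d c := by
    rw [(hA.hasFDerivAt.clm_apply (hasFDerivAt_const c y)).fderiv]
    simp
  rw [extDeriv_apply (differentiableAt_ofSubsingleton hA)]
  simp [Fin.sum_univ_two, Fin.removeNth, h, sub_eq_add_neg]

variable {E' : Type*} [NormedAddCommGroup E'] [NormedSpace ℝ E']
  {H' : Type*} [TopologicalSpace H'] {N : Type*} [TopologicalSpace N] [ChartedSpace H' N]
  {I' : ModelWithCorners ℝ E' H'} [I'.Boundaryless] [IsManifold I' ∞ N]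

/-- The representations of a `1`-form in two charts differ by the pull-back under the transition
map. -/
theorem oneFormInChart_eventuallyEq (θ : (x : N) → TangentSpace I' x →L[ℝ] ℝ) {x₀ x : N}
    (hx : x ∈ (extChartAt I' x₀).source) :
    oneFormInChart I' θ x =ᶠ[𝓝 (extChartAt I' x x)] fun y =>
      (oneFormInChart I' θ x₀ ((extChartAt I' x₀ ∘
        (extChartAt I' x).symm) y)).compContinuousLinearMap
          (fderiv ℝ (extChartAt I' x₀ ∘ (extChartAt I' x).symm) y) := by
  have hnear : ∀ᶠ y in 𝓝 (extChartAt I' x x), y ∈ (extChartAt I' x).target ∧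
      (extChartAt I' x).symm y ∈ (extChartAt I' x₀).source := by
    refine Filter.Eventually.and (extChartAt_target_mem_nhds x) ?_
    refine (continuousAt_extChartAt_symm (I := I') x).eventually ?_
    rw [extChartAt_to_inv]
    exact (isOpen_extChartAt_source x₀).mem_nhds hx
  filter_upwards [hnear.eventually_nhds] with y hy
  obtain ⟨hy1, hy2⟩ := hy.self_of_nhds
  have hinv : (extChartAt I' x₀).symm ((extChartAt I' x₀ ∘ (extChartAt I' x).symm) y) =
      (extChartAt I' x).symm y := (extChartAt I' x₀).left_inv hy2
  have hmem := (extChartAt I' x₀).map_source hy2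
  have hsymm {z : N} {y : E'} (hy : y ∈ (extChartAt I' z).target) :
      MDifferentiableAt 𝓘(ℝ, E') I' (extChartAt I' z).symm y := by
    have := mdifferentiableWithinAt_extChartAt_symm hy
    rwa [ModelWithCorners.Boundaryless.range_eq_univ, mdifferentiableWithinAt_univ] at this
  have hf : MDifferentiableAt 𝓘(ℝ, E') 𝓘(ℝ, E') (extChartAt I' x₀ ∘ (extChartAt I' x).symm) y :=
    (mdifferentiableAt_extChartAt (by simpa using hy2)).comp y (hsymm hy1)
  have hd : mfderiv 𝓘(ℝ, E') I' (extChartAt I' x).symm y =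
      (mfderiv 𝓘(ℝ, E') I' (extChartAt I' x₀).symm
        ((extChartAt I' x₀ ∘ (extChartAt I' x).symm) y)).comp
        (mfderiv 𝓘(ℝ, E') 𝓘(ℝ, E') (extChartAt I' x₀ ∘ (extChartAt I' x).symm) y) := by
    rw [← mfderiv_comp y (hsymm hmem) hf]
    refine Filter.EventuallyEq.mfderiv_eq ?_
    filter_upwards [hy] with z hz
    exact ((extChartAt I' x₀).left_inv hz.2).symm
  have hθ {a b : N} (hab : a = b) (v : E') : θ a v = θ b v := by subst hab; rfl
  ext v
  simp only [oneFormInChart, ContinuousAlternatingMap.compContinuousLinearMap_apply,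
    ContinuousAlternatingMap.ofSubsingleton_apply_apply, hd, mfderiv_eq_fderiv]
  exact (hθ hinv _).symm

theorem contDiffAt_extChartAt_comp_symm {x₀ x : N} (hx : x ∈ (extChartAt I' x₀).source) :
    ContDiffAt ℝ ∞ (extChartAt I' x₀ ∘ (extChartAt I' x).symm) (extChartAt I' x x) := by
  rw [← contMDiffAt_iff_contDiffAt]
  refine ContMDiffAt.comp (I' := I') _ ?_ ?_
  · exact contMDiffAt_extChartAt' (by simpa using hx)
  · exact (contMDiffOn_extChartAt_symm x).contMDiffAt (extChartAt_target_mem_nhds x)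

/-- The exterior derivative of a `1`-form may be computed in any chart. -/
theorem oneFormExtDeriv_eq_extDeriv (θ : (x : N) → TangentSpace I' x →L[ℝ] ℝ) {x₀ x : N}
    (hx : x ∈ (extChartAt I' x₀).source)
    (hθ : DifferentiableAt ℝ (oneFormInChart I' θ x₀) (extChartAt I' x₀ x))
    (u w : TangentSpace I' x) :
    oneFormExtDeriv I' θ x u w = extDeriv (oneFormInChart I' θ x₀) (extChartAt I' x₀ x)
      ![mfderiv I' 𝓘(ℝ, E') (extChartAt I' x₀) x u,
        mfderiv I' 𝓘(ℝ, E') (extChartAt I' x₀) x w] := by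
  have hf := contDiffAt_extChartAt_comp_symm (I' := I') hx
  have hval : (extChartAt I' x₀ ∘ (extChartAt I' x).symm) (extChartAt I' x x) =
      extChartAt I' x₀ x := by
    simp
  have hchain (u : TangentSpace I' x) :
      fderiv ℝ (extChartAt I' x₀ ∘ (extChartAt I' x).symm) (extChartAt I' x x)
        (mfderiv I' 𝓘(ℝ, E') (extChartAt I' x) x u) =
      mfderiv I' 𝓘(ℝ, E') (extChartAt I' x₀) x u := by
    have h1 : MDifferentiableAt I' 𝓘(ℝ, E') (extChartAt I' x) x :=
      mdifferentiableAt_extChartAt (by simp)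
    have h2 : MDifferentiableAt 𝓘(ℝ, E') 𝓘(ℝ, E')
        (extChartAt I' x₀ ∘ (extChartAt I' x).symm) (extChartAt I' x x) :=
      (hf.differentiableAt (by simp)).mdifferentiableAt
    have h3 := mfderiv_comp x h2 h1
    have h4 : (extChartAt I' x₀ ∘ (extChartAt I' x).symm) ∘ extChartAt I' x =ᶠ[𝓝 x]
        extChartAt I' x₀ := by
      filter_upwards [extChartAt_source_mem_nhds (I := I') x] with z hz
      simp only [Function.comp_apply, (extChartAt I' x).left_inv hz]
    rw [h4.mfderiv_eq, mfderiv_eq_fderiv] at h3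
    exact (congrArg (fun l : E' →L[ℝ] E' => l u) h3).symm
  rw [oneFormExtDeriv, (oneFormInChart_eventuallyEq θ hx).extDeriv_eq,
    extDeriv_pullback (r := ∞) (by rwa [hval]) hf
      (by rw [minSmoothness_of_isRCLikeNormedField]; exact ENat.LEInfty.out), hval]
  rw [ContinuousAlternatingMap.compContinuousLinearMap_apply]
  congr 1
  ext i
  fin_cases i
  · exact hchain u
  · exact hchain w

end OneForms

/-! ### The contact form and its Reeb vector -/

section Reeb

variable {E : Type*} [NormedAddCommGroup E] [NormedSpace ℝ E]
  {Q : Type*} [TopologicalSpace Q] [ChartedSpace E Q] [IsManifold 𝓘(ℝ, E) ∞ Q]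
  {F : TangentBundle 𝓘(ℝ, E) Q → ℝ}

theorem mem_target_of_mem_source {x₀ x : TangentBundle 𝓘(ℝ, E) Q}
    (hx : x.proj ∈ (chartAt E x₀.proj).source) :
    (extChartAt 𝓘(ℝ, E).tangent x₀ x).1 ∈ (extChartAt 𝓘(ℝ, E) x₀.proj).target :=
  mem_extChartAt_tangent_target.1 ((extChartAt _ x₀).map_source
      (mem_extChartAt_tangent_source.2 hx))

/-- The form `α = F β` is `(∂G/∂vⁱ) dpⁱ` in a chart, where `G = F² / 2`. -/
theorem finslerForm_eq (hF : IsFinslerMetric F) {x₀ x : TangentBundle 𝓘(ℝ, E) Q}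
    (hx : x.proj ∈ (chartAt E x₀.proj).source) (hv : x.snd ≠ 0)
    (ξ : TangentSpace 𝓘(ℝ, E).tangent x) :
    finslerForm F x ξ =
      fderiv ℝ (localEnergy (localMetric F x₀)) (extChartAt 𝓘(ℝ, E).tangent x₀ x)
        (0, (mfderiv 𝓘(ℝ, E).tangent 𝓘(ℝ, E × E) (extChartAt 𝓘(ℝ, E).tangent x₀) x ξ).1) := by
  have hsrc := mem_extChartAt_tangent_source.2 hx
  have hπ : MDifferentiableAt 𝓘(ℝ, E).tangent 𝓘(ℝ, E)
      (fun y : TangentBundle 𝓘(ℝ, E) Q => y.proj) x :=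
    (Bundle.contMDiff_proj (IB := 𝓘(ℝ, E)) (n := 1) (F := E)
      (TangentSpace 𝓘(ℝ, E) : Q → Type _)).mdifferentiableAt (by simp)
  have hψ : MDifferentiableAt 𝓘(ℝ, E).tangent 𝓘(ℝ, E × E) (extChartAt 𝓘(ℝ, E).tangent x₀) x :=
    mdifferentiableAt_extChartAt (by simpa using hsrc)
  have hφ : MDifferentiableAt 𝓘(ℝ, E) 𝓘(ℝ, E) (extChartAt 𝓘(ℝ, E) x₀.proj) x.proj :=
    mdifferentiableAt_extChartAt hx
  have h1 := mfderiv_comp x hφ hπ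
  have hfst : MDifferentiableAt 𝓘(ℝ, E × E) 𝓘(ℝ, E) (Prod.fst : E × E → E)
      (extChartAt 𝓘(ℝ, E).tangent x₀ x) :=
    differentiableAt_fst.mdifferentiableAt
  have h2 := mfderiv_comp x hfst hψ
  have h3 : (extChartAt 𝓘(ℝ, E) x₀.proj ∘ fun y : TangentBundle 𝓘(ℝ, E) Q => y.proj) =
      (Prod.fst : E × E → E) ∘ extChartAt 𝓘(ℝ, E).tangent x₀ := rfl
  rw [h3, h2, mfderiv_eq_fderiv, fderiv_fst] at h1
  have h4 := congrArg (fun l : E × E →L[ℝ] E => l ξ) h1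
  have h5 := (isLocalFinsler_localMetric hF x₀).fderiv_energy
    (mem_target_of_mem_source hx) ((extChartAt_tangent_snd_ne_zero hx).2 hv)
  rw [h5, localMetric_extChartAt hx]
  change F x * fderiv ℝ (fibreRestrict F x.proj) x.snd _ = F x * _
  rw [fderiv_fibreRestrict hF hx hv]
  exact congrArg (fun z : E => F x * fderiv ℝ (localMetric F x₀)
    (extChartAt 𝓘(ℝ, E).tangent x₀ x) (0, z)) h4.symm

/-- The differential of `F`, in a chart. -/
theorem mfderiv_eq_fderiv_localMetric (hF : IsFinslerMetric F) {x₀ x : TangentBundle 𝓘(ℝ, E) Q}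
    (hx : x.proj ∈ (chartAt E x₀.proj).source) (hv : x.snd ≠ 0)
    (ξ : TangentSpace 𝓘(ℝ, E).tangent x) :
    mfderiv 𝓘(ℝ, E).tangent 𝓘(ℝ, ℝ) F x ξ =
      fderiv ℝ (localMetric F x₀) (extChartAt 𝓘(ℝ, E).tangent x₀ x)
        (mfderiv 𝓘(ℝ, E).tangent 𝓘(ℝ, E × E) (extChartAt 𝓘(ℝ, E).tangent x₀) x ξ) := by
  have hsrc := mem_extChartAt_tangent_source.2 hx
  have hψ : MDifferentiableAt 𝓘(ℝ, E).tangent 𝓘(ℝ, E × E) (extChartAt 𝓘(ℝ, E).tangent x₀) x :=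
    mdifferentiableAt_extChartAt (by simpa using hsrc)
  have hL : MDifferentiableAt 𝓘(ℝ, E × E) 𝓘(ℝ, ℝ) (localMetric F x₀)
      (extChartAt 𝓘(ℝ, E).tangent x₀ x) :=
    ((isLocalFinsler_localMetric hF x₀).differentiableAt
      (mem_target_of_mem_source hx)
      ((extChartAt_tangent_snd_ne_zero hx).2 hv)).mdifferentiableAt
  have h1 := mfderiv_comp x hL hψ
  have h2 : localMetric F x₀ ∘ extChartAt 𝓘(ℝ, E).tangent x₀ =ᶠ[𝓝 x] F := by
    filter_upwards [(isOpen_extChartAt_source (I := 𝓘(ℝ, E).tangent) x₀).mem_nhds hsrc] with z hz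
    exact localMetric_extChartAt (mem_extChartAt_tangent_source.1 hz)
  rw [h2.mfderiv_eq, mfderiv_eq_fderiv] at h1
  exact congrArg (fun l : E × E →L[ℝ] ℝ => l ξ) h1

theorem snd_ne_zero_of_mem_unitBundle (hF : IsFinslerMetric F) {x : TangentBundle 𝓘(ℝ, E) Q}
    (hx : x ∈ unitBundle F) : x.snd ≠ 0 := by
  intro h0
  have h1 := (hF.eq_zero_iff x.proj x.snd).2 h0
  have h2 : F x = 1 := hx
  exact zero_ne_one (h1.symm.trans h2)

theorem mem_unitBundleTangent_iff (hF : IsFinslerMetric F) {x₀ x : TangentBundle 𝓘(ℝ, E) Q}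
    (hx : x.proj ∈ (chartAt E x₀.proj).source) (hu : x ∈ unitBundle F)
    (ξ : TangentSpace 𝓘(ℝ, E).tangent x) :
    ξ ∈ unitBundleTangent F x ↔
      fderiv ℝ (localEnergy (localMetric F x₀)) (extChartAt 𝓘(ℝ, E).tangent x₀ x)
        (mfderiv 𝓘(ℝ, E).tangent 𝓘(ℝ, E × E) (extChartAt 𝓘(ℝ, E).tangent x₀) x ξ) = 0 := by
  have hv := snd_ne_zero_of_mem_unitBundle hF hu
  have hu' : F x = 1 := hu
  rw [(isLocalFinsler_localMetric hF x₀).fderiv_energy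
    (mem_target_of_mem_source hx) ((extChartAt_tangent_snd_ne_zero hx).2 hv),
    localMetric_extChartAt hx, hu', one_smul, ← mfderiv_eq_fderiv_localMetric hF hx hv]
  rfl

theorem oneFormInChart_finslerForm (hF : IsFinslerMetric F) (x₀ : TangentBundle 𝓘(ℝ, E) Q)
    {y : E × E} (hy : y.1 ∈ (extChartAt 𝓘(ℝ, E) x₀.proj).target) (hv : y.2 ≠ 0) :
    oneFormInChart 𝓘(ℝ, E).tangent (finslerForm F) x₀ y =
      ContinuousAlternatingMap.ofSubsingleton ℝ (E × E) ℝ (0 : Fin 1)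
        ((fderiv ℝ (localEnergy (localMetric F x₀)) y).comp
          ((ContinuousLinearMap.inr ℝ E E).comp (ContinuousLinearMap.fst ℝ E E))) := by
  have hy' : y ∈ (extChartAt 𝓘(ℝ, E).tangent x₀).target := mem_extChartAt_tangent_target.2 hy
  have hs := (extChartAt 𝓘(ℝ, E).tangent x₀).map_target hy'
  have hx := mem_extChartAt_tangent_source.1 hs
  have hxv := extChartAt_tangent_snd_ne_zero hx
  have hc := mfderiv_extChartAt_comp_mfderivWithin_extChartAt_symm hy'
  rw [ModelWithCorners.Boundaryless.range_eq_univ, mfderivWithin_univ] at hc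
  rw [oneFormInChart]
  congr 1
  refine ContinuousLinearMap.ext fun ζ => ?_
  have h1 := finslerForm_eq hF hx (hxv.1 (by rwa [(extChartAt _ x₀).right_inv hy']))
    (mfderiv 𝓘(ℝ, E × E) 𝓘(ℝ, E).tangent (extChartAt 𝓘(ℝ, E).tangent x₀).symm y ζ)
  rw [(extChartAt _ x₀).right_inv hy'] at h1
  refine h1.trans ?_
  have h2 := congrArg (fun l : E × E →L[ℝ] E × E => l ζ) hc
  exact congrArg (fun z : E × E => fderiv ℝ (localEnergy (localMetric F x₀)) y (0, z.1)) h2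

theorem oneFormExtDeriv_finslerForm (hF : IsFinslerMetric F) {x₀ x : TangentBundle 𝓘(ℝ, E) Q}
    (hx : x.proj ∈ (chartAt E x₀.proj).source) (hv : x.snd ≠ 0)
    (u w : TangentSpace 𝓘(ℝ, E).tangent x) :
    oneFormExtDeriv 𝓘(ℝ, E).tangent (finslerForm F) x u w =
      localExtDeriv (localMetric F x₀) (extChartAt 𝓘(ℝ, E).tangent x₀ x)
        (mfderiv 𝓘(ℝ, E).tangent 𝓘(ℝ, E × E) (extChartAt 𝓘(ℝ, E).tangent x₀) x u)
        (mfderiv 𝓘(ℝ, E).tangent 𝓘(ℝ, E × E) (extChartAt 𝓘(ℝ, E).tangent x₀) x w) := by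
  have hL := isLocalFinsler_localMetric hF x₀
  have hp := mem_target_of_mem_source hx
  have hv' := (extChartAt_tangent_snd_ne_zero hx).2 hv
  have hG := (hL.differentiableAt_fderiv_energy hp hv').hasFDerivAt.clm_comp
    (hasFDerivAt_const ((ContinuousLinearMap.inr ℝ E E).comp (ContinuousLinearMap.fst ℝ E E)) _)
  have heq : oneFormInChart 𝓘(ℝ, E).tangent (finslerForm F) x₀
      =ᶠ[𝓝 (extChartAt 𝓘(ℝ, E).tangent x₀ x)] fun y =>
      ContinuousAlternatingMap.ofSubsingleton ℝ (E × E) ℝ (0 : Fin 1)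
        ((fderiv ℝ (localEnergy (localMetric F x₀)) y).comp
          ((ContinuousLinearMap.inr ℝ E E).comp (ContinuousLinearMap.fst ℝ E E))) := by
    filter_upwards [hL.isOpen_slit.mem_nhds ⟨hp, hv'⟩] with y hy
    exact oneFormInChart_finslerForm hF x₀ hy.1 hy.2
  have hd : DifferentiableAt ℝ (oneFormInChart 𝓘(ℝ, E).tangent (finslerForm F) x₀)
      (extChartAt 𝓘(ℝ, E).tangent x₀ x) := by
    refine DifferentiableAt.congr_of_eventuallyEq ?_ heq
    exact differentiableAt_ofSubsingleton hG.differentiableAt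
  rw [oneFormExtDeriv_eq_extDeriv _ (mem_extChartAt_tangent_source.2 hx) hd, heq.extDeriv_eq]
  refine (extDeriv_ofSubsingleton hG.differentiableAt _ _).trans ?_
  rw [hG.fderiv, ContinuousLinearMap.comp_zero, zero_add]
  rfl

/-- The Reeb equations may be tested in any chart around the base point. -/
theorem isReebVector_iff (hF : IsFinslerMetric F) {x₀ x : TangentBundle 𝓘(ℝ, E) Q}
    (hx : x.proj ∈ (chartAt E x₀.proj).source) (hu : x ∈ unitBundle F)
    (r : TangentSpace 𝓘(ℝ, E).tangent x) :
    IsReebVector F x r ↔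
      IsLocalReeb (localMetric F x₀) (extChartAt 𝓘(ℝ, E).tangent x₀ x)
        (mfderiv 𝓘(ℝ, E).tangent 𝓘(ℝ, E × E) (extChartAt 𝓘(ℝ, E).tangent x₀) x r) := by
  have hv := snd_ne_zero_of_mem_unitBundle hF hu
  have hsurj := (isInvertible_mfderiv_extChartAt (mem_extChartAt_tangent_source.2 hx)).surjective
  constructor
  · rintro ⟨h1, h2, h3⟩
    refine ⟨(mem_unitBundleTangent_iff hF hx hu r).1 h1, (finslerForm_eq hF hx hv r) ▸ h2, ?_⟩
    intro z hz
    obtain ⟨η, rfl⟩ := hsurj z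
    rw [← h3 η ((mem_unitBundleTangent_iff hF hx hu η).2 hz)]
    exact (oneFormExtDeriv_finslerForm hF hx hv r η).symm
  · rintro ⟨h1, h2, h3⟩
    refine ⟨(mem_unitBundleTangent_iff hF hx hu r).2 h1, (finslerForm_eq hF hx hv r).trans h2, ?_⟩
    intro η hη
    rw [oneFormExtDeriv_finslerForm hF hx hv]
    exact h3 _ ((mem_unitBundleTangent_iff hF hx hu η).1 hη)

theorem localMetric_eq_one {x₀ x : TangentBundle 𝓘(ℝ, E) Q}
    (hx : x.proj ∈ (chartAt E x₀.proj).source) (hu : x ∈ unitBundle F) :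
    localMetric F x₀ (extChartAt 𝓘(ℝ, E).tangent x₀ x) = 1 :=
  (localMetric_extChartAt hx).trans hu

variable [FiniteDimensional ℝ E]

/-- The Reeb vector in a chart is the geodesic spray. -/
theorem isReebVector_iff_geodesicAcceleration (hF : IsFinslerMetric F)
    {x₀ x : TangentBundle 𝓘(ℝ, E) Q} (hx : x.proj ∈ (chartAt E x₀.proj).source)
    (hu : x ∈ unitBundle F) (r : TangentSpace 𝓘(ℝ, E).tangent x) :
    IsReebVector F x r ↔
      mfderiv 𝓘(ℝ, E).tangent 𝓘(ℝ, E × E) (extChartAt 𝓘(ℝ, E).tangent x₀) x r =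
        ((extChartAt 𝓘(ℝ, E).tangent x₀ x).2,
          geodesicAcceleration (localMetric F x₀) (extChartAt 𝓘(ℝ, E).tangent x₀ x)) :=
  (isReebVector_iff hF hx hu r).trans
    ((isLocalFinsler_localMetric hF x₀).isLocalReeb_iff (mem_target_of_mem_source hx)
      ((extChartAt_tangent_snd_ne_zero hx).2 (snd_ne_zero_of_mem_unitBundle hF hu))
      (localMetric_eq_one hx hu))

theorem existsUnique_isReebVector (hF : IsFinslerMetric F) {x : TangentBundle 𝓘(ℝ, E) Q}
    (hu : x ∈ unitBundle F) : ∃! r : TangentSpace 𝓘(ℝ, E).tangent x, IsReebVector F x r := by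
  have hx : x.proj ∈ (chartAt E x.proj).source := mem_chart_source E x.proj
  have hinv := isInvertible_mfderiv_extChartAt (I := 𝓘(ℝ, E).tangent)
    (mem_extChartAt_tangent_source.2 hx)
  simp only [isReebVector_iff_geodesicAcceleration hF hx hu]
  exact hinv.bijective.existsUnique _

theorem isContactOnUnitBundle (hF : IsFinslerMetric F) : IsContactOnUnitBundle F := by
  intro x hu
  have hx : x.proj ∈ (chartAt E x.proj).source := mem_chart_source E x.proj
  have hv := snd_ne_zero_of_mem_unitBundle hF hu
  have hinv := isInvertible_mfderiv_extChartAt (I := 𝓘(ℝ, E).tangent)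
    (mem_extChartAt_tangent_source.2 hx)
  constructor
  · obtain ⟨r, hr, -⟩ := existsUnique_isReebVector hF hu
    exact ⟨r, hr.tangent, by rw [hr.normalized]; exact one_ne_zero⟩
  · intro ξ hξ hα hker
    have h0 : mfderiv 𝓘(ℝ, E).tangent 𝓘(ℝ, E × E) (extChartAt 𝓘(ℝ, E).tangent x) x ξ =
        (0 : E × E) := by
      refine (isLocalFinsler_localMetric hF x).eq_zero_of_localExtDeriv_eq_zero
        (mem_target_of_mem_source hx) ((extChartAt_tangent_snd_ne_zero hx).2 hv)
        (localMetric_eq_one hx hu) ((mem_unitBundleTangent_iff hF hx hu ξ).1 hξ)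
        ((finslerForm_eq hF hx hv ξ).symm.trans hα) ?_
      intro b hb hb'
      obtain ⟨η, rfl⟩ := hinv.surjective b
      exact (oneFormExtDeriv_finslerForm hF hx hv ξ η).symm.trans
        (hker η ((mem_unitBundleTangent_iff hF hx hu η).2 hb)
          ((finslerForm_eq hF hx hv η).trans hb'))
    exact hinv.injective (h0.trans (map_zero _).symm)

end Reeb

/-! ### Curves in the tangent bundle in charts -/

section Curves

theorem nonempty_interior_of_ordConnected {J : Set ℝ} (hJ : J.OrdConnected)
    (hJ' : J.Nontrivial) : (interior J).Nonempty := by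
  obtain ⟨a, ha, b, hb, hab⟩ := hJ'.exists_lt
  refine ⟨(a + b) / 2, interior_mono (hJ.out ha hb) ?_⟩
  rw [interior_Icc]
  constructor <;> linarith

theorem uniqueDiffOn_of_ordConnected {J : Set ℝ} (hJ : J.OrdConnected) (hJ' : J.Nontrivial) :
    UniqueDiffOn ℝ J :=
  uniqueDiffOn_convex hJ.convex (nonempty_interior_of_ordConnected hJ hJ')

theorem subset_closure_interior_of_ordConnected {J : Set ℝ} (hJ : J.OrdConnected)
    (hJ' : J.Nontrivial) : J ⊆ closure (interior J) := by
  rw [(hJ.convex (𝕜 := ℝ)).closure_interior_eq_closure_of_nonempty_interior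
    (nonempty_interior_of_ordConnected hJ hJ')]
  exact subset_closure

theorem hasDerivWithinAt_of_comp_smulRight {W : Type*} [NormedAddCommGroup W] [NormedSpace ℝ W]
    {y : ℝ → W} {A : W →L[ℝ] W} {r : W} {J : Set ℝ} {t : ℝ}
    (h : HasFDerivWithinAt y (A.comp ((1 : ℝ →L[ℝ] ℝ).smulRight r)) J t) :
    HasDerivWithinAt y (A r) J t := by
  simpa using h.hasDerivWithinAt

variable {E : Type*} [NormedAddCommGroup E] [NormedSpace ℝ E]
  {Q : Type*} [TopologicalSpace Q] [ChartedSpace E Q] [IsManifold 𝓘(ℝ, E) ∞ Q]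
  {F : TangentBundle 𝓘(ℝ, E) Q → ℝ}

/-- The velocity curve of `γ`, in a chart. -/
theorem extChartAt_velocityLift {x₀ : TangentBundle 𝓘(ℝ, E) Q} {γ : ℝ → Q} {J : Set ℝ} {t : ℝ}
    (hx : γ t ∈ (chartAt E x₀.proj).source) (hJ : UniqueDiffWithinAt ℝ J t)
    (hγ : MDifferentiableWithinAt 𝓘(ℝ, ℝ) 𝓘(ℝ, E) γ J t) :
    extChartAt 𝓘(ℝ, E).tangent x₀ (velocityLift γ J t) =
      (extChartAt 𝓘(ℝ, E) x₀.proj (γ t),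
        derivWithin (fun t => extChartAt 𝓘(ℝ, E) x₀.proj (γ t)) J t) := by
  rw [extChartAt_tangent_apply (x := velocityLift γ J t) hx]
  have h1 := mfderiv_comp_mfderivWithin t
    (mdifferentiableAt_extChartAt (I := 𝓘(ℝ, E)) (x := x₀.proj) hx) hγ hJ.uniqueMDiffWithinAt
  rw [mfderivWithin_eq_fderivWithin] at h1
  have h2 := congrArg (fun l : ℝ →L[ℝ] E => l 1) h1
  refine Prod.ext rfl ?_
  rw [← fderivWithin_derivWithin]
  exact h2.symm

/-- The derivative of a curve in `TQ`, in a chart. -/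
theorem hasDerivWithinAt_extChartAt_tangent {x₀ : TangentBundle 𝓘(ℝ, E) Q}
    {Γ : ℝ → TangentBundle 𝓘(ℝ, E) Q} {J : Set ℝ} {t : ℝ}
    (hx : (Γ t).proj ∈ (chartAt E x₀.proj).source) {r : TangentSpace 𝓘(ℝ, E).tangent (Γ t)}
    (h : HasMFDerivWithinAt 𝓘(ℝ, ℝ) 𝓘(ℝ, E).tangent Γ J t ((1 : ℝ →L[ℝ] ℝ).smulRight r)) :
    HasDerivWithinAt (fun t => extChartAt 𝓘(ℝ, E).tangent x₀ (Γ t))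
      (mfderiv 𝓘(ℝ, E).tangent 𝓘(ℝ, E × E) (extChartAt 𝓘(ℝ, E).tangent x₀) (Γ t) r) J t := by
  have hψ : MDifferentiableAt 𝓘(ℝ, E).tangent 𝓘(ℝ, E × E) (extChartAt 𝓘(ℝ, E).tangent x₀) (Γ t) :=
    mdifferentiableAt_extChartAt (by simpa using mem_extChartAt_tangent_source.2 hx)
  exact hasDerivWithinAt_of_comp_smulRight (W := E × E)
    (A := mfderiv 𝓘(ℝ, E).tangent 𝓘(ℝ, E × E) (extChartAt 𝓘(ℝ, E).tangent x₀) (Γ t))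
    (hψ.hasMFDerivAt.comp_hasMFDerivWithinAt t h).hasFDerivWithinAt

theorem hasMFDerivWithinAt_of_hasDerivWithinAt {Γ : ℝ → TangentBundle 𝓘(ℝ, E) Q} {J : Set ℝ}
    {t : ℝ} (hΓ : ContinuousWithinAt Γ J t) {r : TangentSpace 𝓘(ℝ, E).tangent (Γ t)}
    (h : HasDerivWithinAt (fun s => extChartAt 𝓘(ℝ, E).tangent (Γ t) (Γ s))
      (mfderiv 𝓘(ℝ, E).tangent 𝓘(ℝ, E × E) (extChartAt 𝓘(ℝ, E).tangent (Γ t)) (Γ t) r) J t) :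
    HasMFDerivWithinAt 𝓘(ℝ, ℝ) 𝓘(ℝ, E).tangent Γ J t ((1 : ℝ →L[ℝ] ℝ).smulRight r) := by
  rw [mfderiv_extChartAt_self] at h
  refine ⟨hΓ, ?_⟩
  have h1 : HasFDerivWithinAt (fun s => extChartAt 𝓘(ℝ, E).tangent (Γ t) (Γ s))
      ((1 : ℝ →L[ℝ] ℝ).smulRight (r : E × E)) J t := by
    refine h.hasFDerivWithinAt.congr_fderiv ?_
    ext1
    rfl
  have h2 : (extChartAt 𝓘(ℝ, ℝ) t).symm ⁻¹' J ∩ range 𝓘(ℝ, ℝ) = J := by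
    simp only [extChartAt_model_space_eq_id, ModelWithCorners.Boundaryless.range_eq_univ,
      inter_univ]
    rfl
  rw [h2]
  exact h1

end Curves

/-! ### Integrals depending on a parameter -/

section ParametricIntegral

theorem uniqueDiffOn_strip {a b ε : ℝ} (hab : a < b) :
    UniqueDiffOn ℝ (Ioo (-ε) ε ×ˢ Icc a b) :=
  isOpen_Ioo.uniqueDiffOn.prod (uniqueDiffOn_Icc hab)

theorem hasDerivAt_slice {V : Type*} [NormedAddCommGroup V] [NormedSpace ℝ V]
    {h : ℝ × ℝ → V} {a b ε s t : ℝ} (hs : s ∈ Ioo (-ε) ε)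
    (ht : t ∈ Icc a b) (hd : DifferentiableWithinAt ℝ h (Ioo (-ε) ε ×ˢ Icc a b) (s, t)) :
    HasDerivAt (fun s => h (s, t)) (fderivWithin ℝ h (Ioo (-ε) ε ×ˢ Icc a b) (s, t) (1, 0)) s := by
  have h1 : HasDerivWithinAt (fun s : ℝ => (s, t)) (1, 0) (Ioo (-ε) ε) s :=
    ((hasDerivAt_id s).prodMk (hasDerivAt_const s t)).hasDerivWithinAt
  have h2 := hd.hasFDerivWithinAt.comp_hasDerivWithinAt s h1
    (show MapsTo (fun s : ℝ => (s, t)) (Ioo (-ε) ε) (Ioo (-ε) ε ×ˢ Icc a b) from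
      fun r hr => ⟨hr, ht⟩)
  exact h2.hasDerivAt (isOpen_Ioo.mem_nhds hs)

theorem hasDerivWithinAt_slice {V : Type*} [NormedAddCommGroup V] [NormedSpace ℝ V]
    {h : ℝ × ℝ → V} {a b ε s t : ℝ} (hs : s ∈ Ioo (-ε) ε)
    (hd : DifferentiableWithinAt ℝ h (Ioo (-ε) ε ×ˢ Icc a b) (s, t)) :
    HasDerivWithinAt (fun t => h (s, t))
      (fderivWithin ℝ h (Ioo (-ε) ε ×ˢ Icc a b) (s, t) (0, 1)) (Icc a b) t := by
  have h1 : HasDerivWithinAt (fun t : ℝ => (s, t)) (0, 1) (Icc a b) t :=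
    ((hasDerivAt_const t s).prodMk (hasDerivAt_id t)).hasDerivWithinAt
  exact hd.hasFDerivWithinAt.comp_hasDerivWithinAt t h1
    (show MapsTo (fun t : ℝ => (s, t)) (Icc a b) (Ioo (-ε) ε ×ˢ Icc a b) from
      fun r hr => ⟨hs, hr⟩)

/-- Differentiation under the integral sign, for a function that is `C¹` near `{0} × [a, b]`. -/
theorem hasDerivAt_integral_of_contDiffWithinAt {h : ℝ × ℝ → ℝ} {a b ε : ℝ} (hab : a < b)
    (hε : 0 < ε)
    (hh : ∀ t ∈ Icc a b, ContDiffWithinAt ℝ 1 h (Ioo (-ε) ε ×ˢ Icc a b) (0, t)) :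
    IntervalIntegrable (fun t => deriv (fun s => h (s, t)) 0) MeasureTheory.volume a b ∧
    HasDerivAt (fun s => ∫ t in a..b, h (s, t)) (∫ t in a..b, deriv (fun s => h (s, t)) 0) 0 := by
  set S : Set (ℝ × ℝ) := Ioo (-ε) ε ×ˢ Icc a b with hS
  have hSu : UniqueDiffOn ℝ S := uniqueDiffOn_strip hab
  have h0 : (0 : ℝ) ∈ Ioo (-ε) ε := ⟨by linarith, hε⟩
  -- By compactness of `[a, b]`, the hypothesis extends to a strip around `{0} × [a, b]`.
  have h1 : ∀ᶠ s in 𝓝 (0 : ℝ), ∀ t ∈ Icc a b, (s, t) ∈ S → ContDiffWithinAt ℝ 1 h S (s, t) := by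
    refine isCompact_Icc.eventually_forall_of_forall_eventually fun t ht => ?_
    have h2 := (hh t ht).eventually (by simp)
    rw [insert_eq_of_mem (show ((0 : ℝ), t) ∈ S from ⟨h0, ht⟩), eventually_nhdsWithin_iff] at h2
    exact h2
  obtain ⟨δ, hδ, hδs⟩ := Metric.eventually_nhds_iff.1 (h1.and (isOpen_Ioo.mem_nhds h0))
  have hδ2 : ∀ s ∈ Icc (-(δ / 2)) (δ / 2), dist s 0 < δ := by
    intro s hs
    rw [Real.dist_eq, sub_zero, abs_lt]
    constructor <;> linarith [hs.1, hs.2]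
  have hC1 : ∀ s ∈ Icc (-(δ / 2)) (δ / 2), ∀ t ∈ Icc a b,
      (s, t) ∈ S ∧ ContDiffWithinAt ℝ 1 h S (s, t) := by
    intro s hs t ht
    have hmem : (s, t) ∈ S := ⟨(hδs (hδ2 s hs)).2, ht⟩
    exact ⟨hmem, (hδs (hδ2 s hs)).1 t ht hmem⟩
  set K : Set (ℝ × ℝ) := Icc (-(δ / 2)) (δ / 2) ×ˢ Icc a b with hK
  have hKS : K ⊆ S := fun p hp => (hC1 p.1 hp.1 p.2 hp.2).1
  have hcont : ContinuousOn (fun p => fderivWithin ℝ h S p (1, 0)) K := by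
    intro p hp
    obtain ⟨hpS, hpC⟩ := hC1 p.1 hp.1 p.2 hp.2
    have h3 : ContinuousWithinAt (fderivWithin ℝ h S) S p :=
      (hpC.fderivWithin_right hSu (m := 0) (by simp) hpS).continuousWithinAt
    exact (h3.mono hKS).clm_apply continuousWithinAt_const
  obtain ⟨C, hC⟩ := (isCompact_Icc.prod isCompact_Icc).exists_bound_of_continuousOn hcont
  have hslice : ∀ s ∈ Icc (-(δ / 2)) (δ / 2), ∀ t ∈ Icc a b,
      HasDerivAt (fun s => h (s, t)) (fderivWithin ℝ h S (s, t) (1, 0)) s := fun s hs t ht =>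
    hasDerivAt_slice (hC1 s hs t ht).1.1 ht ((hC1 s hs t ht).2.differentiableWithinAt (by simp))
  have h0K : (0 : ℝ) ∈ Icc (-(δ / 2)) (δ / 2) := by constructor <;> linarith
  have hmk : ∀ s ∈ Icc (-(δ / 2)) (δ / 2), MapsTo (fun t : ℝ => (s, t)) (Icc a b) K :=
    fun s hs t ht => ⟨hs, ht⟩
  have hhc : ∀ s ∈ Icc (-(δ / 2)) (δ / 2), ContinuousOn (fun t => h (s, t)) (Icc a b) := by
    intro s hs
    have h4 : ContinuousOn h K := fun p hp =>
      (hC1 p.1 hp.1 p.2 hp.2).2.continuousWithinAt.mono hKS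
    exact h4.comp (by fun_prop) (hmk s hs)
  have hF'c : ContinuousOn (fun t => fderivWithin ℝ h S (0, t) (1, 0)) (Icc a b) :=
    hcont.comp (f := fun t : ℝ => ((0 : ℝ), t)) (by fun_prop) (hmk 0 h0K)
  have hIoc : uIoc a b ⊆ Icc a b := by rw [uIoc_of_le hab.le]; exact Ioc_subset_Icc_self
  have hIcc : Icc a b = uIcc a b := (uIcc_of_le hab.le).symm
  have hnhds : Icc (-(δ / 2)) (δ / 2) ∈ 𝓝 (0 : ℝ) := Icc_mem_nhds (by linarith) (by linarith)
  have hkey := intervalIntegral.hasDerivAt_integral_of_dominated_loc_of_deriv_le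
    (μ := MeasureTheory.volume) (F := fun s t => h (s, t)) (a := a) (b := b)
    (F' := fun s t => fderivWithin ℝ h S (s, t) (1, 0)) (bound := fun _ => C) (x₀ := (0 : ℝ))
    hnhds ?_ ?_ ?_ ?_ ?_ ?_
  · have heq : EqOn (fun t => deriv (fun s => h (s, t)) 0)
        (fun t => fderivWithin ℝ h S (0, t) (1, 0)) (uIcc a b) := fun t ht =>
      (hslice 0 h0K t (hIcc ▸ ht)).deriv
    rw [intervalIntegral.integral_congr heq]
    refine ⟨hkey.1.congr ?_, hkey.2⟩
    exact fun t ht => (heq (uIoc_subset_uIcc ht)).symm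
  · filter_upwards [hnhds] with s hs
    exact ((hhc s hs).mono hIoc).aestronglyMeasurable measurableSet_uIoc
  · exact ((hhc 0 h0K).mono hIcc.ge).intervalIntegrable
  · exact (hF'c.mono hIoc).aestronglyMeasurable measurableSet_uIoc
  · exact Filter.Eventually.of_forall fun t ht s hs => hC (s, t) ⟨hs, hIoc ht⟩
  · exact intervalIntegrable_const
  · exact Filter.Eventually.of_forall fun t ht s hs => hslice s hs t (hIoc ht)

end ParametricIntegral

/-! ### The first variation of the length -/

section Variations

variable {E : Type*} [NormedAddCommGroup E] [NormedSpace ℝ E]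
  {Q : Type*} [TopologicalSpace Q] [ChartedSpace E Q]

theorem velocityLift_eq_of_eqOn {γ γ' : ℝ → Q} {J K : Set ℝ} {t : ℝ} (hKJ : K ⊆ J)
    (h : EqOn γ' γ K) (ht : t ∈ K) (hK : UniqueDiffWithinAt ℝ K t)
    (hγ : MDifferentiableWithinAt 𝓘(ℝ, ℝ) 𝓘(ℝ, E) γ J t) :
    velocityLift (E := E) γ' K t = velocityLift γ J t := by
  have h1 := tangentMapWithin_congr (I := 𝓘(ℝ, ℝ)) (I' := 𝓘(ℝ, E)) h ⟨t, (1 : ℝ)⟩ ht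
  have h2 := tangentMapWithin_subset (I := 𝓘(ℝ, ℝ)) (I' := 𝓘(ℝ, E)) (f := γ)
    (p := ⟨t, (1 : ℝ)⟩) hKJ hK.uniqueMDiffWithinAt hγ
  exact h1.trans h2

variable [IsManifold 𝓘(ℝ, E) ∞ Q] {F : TangentBundle 𝓘(ℝ, E) Q → ℝ} {c : ℝ → ℝ → Q} {a b ε : ℝ}

theorem contDiffWithinAt_extChartAt_variation
    (hc : ContMDiffOn 𝓘(ℝ, ℝ × ℝ) 𝓘(ℝ, E) ∞ (fun p : ℝ × ℝ => c p.1 p.2)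
      (Ioo (-ε) ε ×ˢ Icc a b)) {q₀ : Q} {s t : ℝ}
    (hs : s ∈ Ioo (-ε) ε) (ht : t ∈ Icc a b) (hx : c s t ∈ (chartAt E q₀).source) :
    ContDiffWithinAt ℝ ∞ (fun p : ℝ × ℝ => extChartAt 𝓘(ℝ, E) q₀ (c p.1 p.2))
      (Ioo (-ε) ε ×ˢ Icc a b) (s, t) := by
  rw [← contMDiffWithinAt_iff_contDiffWithinAt]
  exact (contMDiffAt_extChartAt' (n := ∞) (x' := c s t) hx).comp_contMDiffWithinAt
    (s, t) (hc (s, t) ⟨hs, ht⟩)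

theorem extChartAt_velocityLift_variation (hab : a < b)
    (hc : ContMDiffOn 𝓘(ℝ, ℝ × ℝ) 𝓘(ℝ, E) ∞ (fun p : ℝ × ℝ => c p.1 p.2)
      (Ioo (-ε) ε ×ˢ Icc a b)) {x₀ : TangentBundle 𝓘(ℝ, E) Q} {s t : ℝ}
    (hs : s ∈ Ioo (-ε) ε) (ht : t ∈ Icc a b) (hx : c s t ∈ (chartAt E x₀.proj).source) :
    extChartAt 𝓘(ℝ, E).tangent x₀ (velocityLift (c s) (Icc a b) t) =
      (extChartAt 𝓘(ℝ, E) x₀.proj (c s t),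
        fderivWithin ℝ (fun p : ℝ × ℝ => extChartAt 𝓘(ℝ, E) x₀.proj (c p.1 p.2))
          (Ioo (-ε) ε ×ˢ Icc a b) (s, t) (0, 1)) := by
  have hu := uniqueDiffOn_Icc hab t ht
  have hm : MDifferentiableWithinAt 𝓘(ℝ, ℝ) 𝓘(ℝ, E) (c s) (Icc a b) t := by
    have h1 : MDifferentiableWithinAt 𝓘(ℝ, ℝ) 𝓘(ℝ, ℝ × ℝ) (fun t : ℝ => (s, t)) (Icc a b) t :=
      DifferentiableAt.mdifferentiableAt (by fun_prop) |>.mdifferentiableWithinAt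
    exact MDifferentiableWithinAt.comp (g := fun p : ℝ × ℝ => c p.1 p.2)
      (f := fun t : ℝ => (s, t)) t ((hc (s, t) ⟨hs, ht⟩).mdifferentiableWithinAt (by simp)) h1
      (fun r hr => ⟨hs, hr⟩)
  rw [extChartAt_velocityLift hx hu hm]
  refine Prod.ext rfl ?_
  exact (hasDerivWithinAt_slice (h := fun p : ℝ × ℝ => extChartAt 𝓘(ℝ, E) x₀.proj (c p.1 p.2)) hs
    ((contDiffWithinAt_extChartAt_variation hc hs ht hx).differentiableWithinAt
      (by simp))).derivWithin hu

/-- The fibre derivative of `F` at the velocity of `c s`, applied to the variation field `∂c/∂s`. It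
is defined without charts, so that it makes sense along all of `[a, b]`. -/
noncomputable def variationMomentum (F : TangentBundle 𝓘(ℝ, E) Q → ℝ) (c : ℝ → ℝ → Q)
    (a b ε : ℝ) (s t : ℝ) : ℝ :=
  fderiv ℝ (fibreRestrict F (c s t)) (velocityLift (c s) (Icc a b) t).snd
    (mfderivWithin 𝓘(ℝ, ℝ × ℝ) 𝓘(ℝ, E) (fun p : ℝ × ℝ => c p.1 p.2) (Ioo (-ε) ε ×ˢ Icc a b)
      (s, t) (1, 0))

theorem variationMomentum_eq (hF : IsFinslerMetric F) (hab : a < b)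
    (hc : ContMDiffOn 𝓘(ℝ, ℝ × ℝ) 𝓘(ℝ, E) ∞ (fun p : ℝ × ℝ => c p.1 p.2)
      (Ioo (-ε) ε ×ˢ Icc a b)) {x₀ : TangentBundle 𝓘(ℝ, E) Q} {s t : ℝ}
    (hs : s ∈ Ioo (-ε) ε) (ht : t ∈ Icc a b) (hx : c s t ∈ (chartAt E x₀.proj).source)
    (hv : (velocityLift (E := E) (c s) (Icc a b) t).snd ≠ 0) :
    variationMomentum F c a b ε s t =
      fderiv ℝ (localMetric F x₀)
        (extChartAt 𝓘(ℝ, E).tangent x₀ (velocityLift (c s) (Icc a b) t))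
        (0, fderivWithin ℝ (fun p : ℝ × ℝ => extChartAt 𝓘(ℝ, E) x₀.proj (c p.1 p.2))
          (Ioo (-ε) ε ×ˢ Icc a b) (s, t) (1, 0)) := by
  have h1 := fderiv_fibreRestrict hF (x₀ := x₀) (x := velocityLift (c s) (Icc a b) t) hx hv
    (mfderivWithin 𝓘(ℝ, ℝ × ℝ) 𝓘(ℝ, E) (fun p : ℝ × ℝ => c p.1 p.2) (Ioo (-ε) ε ×ˢ Icc a b)
      (s, t) (1, 0))
  refine h1.trans ?_
  have h2 := mfderiv_comp_mfderivWithin (I' := 𝓘(ℝ, E)) (s, t)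
    (f := fun p : ℝ × ℝ => c p.1 p.2)
    (mdifferentiableAt_extChartAt (I := 𝓘(ℝ, E)) (x := x₀.proj) hx)
    ((hc (s, t) ⟨hs, ht⟩).mdifferentiableWithinAt (by simp))
    (uniqueDiffOn_strip hab (s, t) ⟨hs, ht⟩).uniqueMDiffWithinAt
  rw [mfderivWithin_eq_fderivWithin] at h2
  have h3 := congrArg (fun l : ℝ × ℝ →L[ℝ] E => l (1, 0)) h2
  exact congrArg (fun z : E => fderiv ℝ (localMetric F x₀)
        (extChartAt 𝓘(ℝ, E).tangent x₀ (velocityLift (c s) (Icc a b) t)) (0, z)) h3.symm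

/-- At a point where the velocity does not vanish, the integrand of the length of a variation is
smooth, and its derivative in the parameter is given by the chain rule in a chart. -/
theorem contDiffWithinAt_speed_variation (hF : IsFinslerMetric F) (hab : a < b)
    (hc : ContMDiffOn 𝓘(ℝ, ℝ × ℝ) 𝓘(ℝ, E) ∞ (fun p : ℝ × ℝ => c p.1 p.2)
      (Ioo (-ε) ε ×ˢ Icc a b)) {x₀ : TangentBundle 𝓘(ℝ, E) Q} {s t : ℝ}
    (hs : s ∈ Ioo (-ε) ε) (ht : t ∈ Icc a b) (hx : c s t ∈ (chartAt E x₀.proj).source)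
    (hv : (velocityLift (E := E) (c s) (Icc a b) t).snd ≠ 0) :
    ContDiffWithinAt ℝ ∞ (fun p : ℝ × ℝ => F (velocityLift (c p.1) (Icc a b) p.2))
      (Ioo (-ε) ε ×ˢ Icc a b) (s, t) ∧
    HasDerivAt (fun s => F (velocityLift (c s) (Icc a b) t))
      (fderiv ℝ (localMetric F x₀)
        (extChartAt 𝓘(ℝ, E).tangent x₀ (velocityLift (c s) (Icc a b) t))
        (fderivWithin ℝ (fun p : ℝ × ℝ => extChartAt 𝓘(ℝ, E) x₀.proj (c p.1 p.2))
          (Ioo (-ε) ε ×ˢ Icc a b) (s, t) (1, 0),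
        fderivWithin ℝ (fderivWithin ℝ
          (fun p : ℝ × ℝ => extChartAt 𝓘(ℝ, E) x₀.proj (c p.1 p.2)) (Ioo (-ε) ε ×ˢ Icc a b))
          (Ioo (-ε) ε ×ˢ Icc a b) (s, t) (1, 0) (0, 1))) s := by
  set S : Set (ℝ × ℝ) := Ioo (-ε) ε ×ˢ Icc a b with hS
  set û : ℝ × ℝ → E := fun p : ℝ × ℝ => extChartAt 𝓘(ℝ, E) x₀.proj (c p.1 p.2) with hû
  have hmem : (s, t) ∈ S := ⟨hs, ht⟩
  have hSu : UniqueDiffOn ℝ S := uniqueDiffOn_strip hab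
  have hu : ContDiffWithinAt ℝ ∞ û S (s, t) := contDiffWithinAt_extChartAt_variation hc hs ht hx
  have hdu : ContDiffWithinAt ℝ ∞ (fderivWithin ℝ û S) S (s, t) :=
    hu.fderivWithin_right hSu (by simp) hmem
  have hw : ContDiffWithinAt ℝ ∞ (fun p => (û p, fderivWithin ℝ û S p (0, 1))) S (s, t) :=
    hu.prodMk (hdu.clm_apply contDiffWithinAt_const)
  have hval := extChartAt_velocityLift_variation hab hc hs ht hx
  have hL := isLocalFinsler_localMetric hF x₀
  have hp := mem_target_of_mem_source (x := velocityLift (c s) (Icc a b) t) hx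
  have hv' := (extChartAt_tangent_snd_ne_zero (x := velocityLift (c s) (Icc a b) t) hx).2 hv
  have hnear : ∀ᶠ p in 𝓝[S] (s, t), F (velocityLift (c p.1) (Icc a b) p.2) =
      localMetric F x₀ (û p, fderivWithin ℝ û S p (0, 1)) := by
    have h1 : ∀ᶠ p in 𝓝[S] (s, t), c p.1 p.2 ∈ (chartAt E x₀.proj).source :=
      (hc (s, t) hmem).continuousWithinAt.eventually ((chartAt E x₀.proj).open_source.mem_nhds hx)
    filter_upwards [h1, self_mem_nhdsWithin] with p hp1 hp2
    rw [← extChartAt_velocityLift_variation hab hc hp2.1 hp2.2 hp1]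
    exact (localMetric_extChartAt (x := velocityLift (c p.1) (Icc a b) p.2) hp1).symm
  constructor
  · refine ContDiffWithinAt.congr_of_eventuallyEq_of_mem ?_ hnear hmem
    refine ContDiffAt.comp_contDiffWithinAt (g := localMetric F x₀) (s, t) ?_ hw
    rw [← hval]
    exact hL.contDiffAt hp hv'
  · have h1 := hasDerivAt_slice hs ht (hu.differentiableWithinAt (by simp))
    have h2 := hasDerivAt_slice hs ht (hdu.differentiableWithinAt (by simp))
    have h3 := h1.prodMk (h2.clm_apply (hasDerivAt_const s ((0, 1) : ℝ × ℝ)))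
    have h4 := (hL.differentiableAt hp hv').hasFDerivAt
    rw [hval] at h4 ⊢
    have h5 := HasFDerivAt.comp_hasDerivAt
      (f := fun s => (û (s, t), fderivWithin ℝ û S (s, t) (0, 1))) s h4 h3
    rw [map_zero, add_zero] at h5
    refine h5.congr_of_eventuallyEq ?_
    have h6 : Filter.Tendsto (fun s : ℝ => (s, t)) (𝓝 s) (𝓝[S] (s, t)) := by
      refine tendsto_nhdsWithin_iff.2 ⟨Continuous.tendsto (by fun_prop) s, ?_⟩
      filter_upwards [isOpen_Ioo.mem_nhds hs] with r hr
      exact ⟨hr, ht⟩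
    exact h6.eventually hnear

/-- The Euler-Lagrange equation `d/dt (∂F/∂v) = ∂F/∂p` at `t` along the curve `Γ` in `TQ`, written
in the preferred chart at `Γ t`. -/
def EulerLagrangeAt (F : TangentBundle 𝓘(ℝ, E) Q → ℝ) (Γ : ℝ → TangentBundle 𝓘(ℝ, E) Q)
    (J : Set ℝ) (t : ℝ) : Prop :=
  HasDerivWithinAt
    (fun s => (fderiv ℝ (localMetric F (Γ t)) (extChartAt 𝓘(ℝ, E).tangent (Γ t) (Γ s))).comp
      (ContinuousLinearMap.inr ℝ E E))
    ((fderiv ℝ (localMetric F (Γ t)) (extChartAt 𝓘(ℝ, E).tangent (Γ t) (Γ t))).comp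
      (ContinuousLinearMap.inl ℝ E E)) J t

/-- Along a solution of the Euler-Lagrange equation, the derivative of the speed in the parameter
of a variation is the derivative of the momentum in time, by the symmetry of the second derivatives
of the variation. -/
theorem hasDerivWithinAt_variationMomentum (hF : IsFinslerMetric F) (hab : a < b) (hε : 0 < ε)
    (hc : ContMDiffOn 𝓘(ℝ, ℝ × ℝ) 𝓘(ℝ, E) ∞ (fun p : ℝ × ℝ => c p.1 p.2)
      (Ioo (-ε) ε ×ˢ Icc a b))
    (hu : ∀ t ∈ Icc a b, velocityLift (c 0) (Icc a b) t ∈ unitBundle F) {t : ℝ}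
    (ht : t ∈ Icc a b) (hEL : EulerLagrangeAt F (velocityLift (c 0) (Icc a b)) (Icc a b) t) :
    HasDerivWithinAt (variationMomentum F c a b ε 0)
      (deriv (fun s => F (velocityLift (c s) (Icc a b) t)) 0) (Icc a b) t := by
  have hs : (0 : ℝ) ∈ Ioo (-ε) ε := ⟨by linarith, hε⟩
  set Γ : ℝ → TangentBundle 𝓘(ℝ, E) Q := velocityLift (c 0) (Icc a b) with hΓ
  have hsrc : c 0 t ∈ (chartAt E (Γ t).proj).source := mem_chart_source E (c 0 t)
  rw [(contDiffWithinAt_speed_variation hF hab hc hs ht hsrc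
    (snd_ne_zero_of_mem_unitBundle hF (hu t ht))).2.deriv]
  set S : Set (ℝ × ℝ) := Ioo (-ε) ε ×ˢ Icc a b with hS
  set û : ℝ × ℝ → E := fun p : ℝ × ℝ => extChartAt 𝓘(ℝ, E) (Γ t).proj (c p.1 p.2) with hû
  have hmem : ((0 : ℝ), t) ∈ S := ⟨hs, ht⟩
  have hSu : UniqueDiffOn ℝ S := uniqueDiffOn_strip hab
  have huc : ContDiffWithinAt ℝ ∞ û S (0, t) := contDiffWithinAt_extChartAt_variation hc hs ht hsrc
  have hdu : ContDiffWithinAt ℝ ∞ (fderivWithin ℝ û S) S (0, t) :=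
    huc.fderivWithin_right hSu (by simp) hmem
  have hclos : ((0 : ℝ), t) ∈ closure (interior S) := by
    rw [hS, interior_prod_eq, interior_Ioo, interior_Icc, closure_prod_eq, closure_Ioo hab.ne]
    exact ⟨subset_closure hs, ht⟩
  have hsymm := (huc.isSymmSndFDerivWithinAt
    (by rw [minSmoothness_of_isRCLikeNormedField]; exact ENat.LEInfty.out) hSu hclos hmem).eq
    (1, 0) (0, 1)
  have h1 := (hasDerivWithinAt_slice hs (hdu.differentiableWithinAt (by simp))).clm_apply
    (hasDerivWithinAt_const t (Icc a b) ((1, 0) : ℝ × ℝ))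
  have h2 := HasDerivWithinAt.clm_apply hEL h1
  rw [map_zero, add_zero, ← hsymm] at h2
  have h3 : ∀ᶠ r in 𝓝[Icc a b] t, c 0 r ∈ (chartAt E (Γ t).proj).source := by
    have h4 : ContinuousWithinAt (fun r => c 0 r) (Icc a b) t :=
      ContinuousWithinAt.comp (g := fun p : ℝ × ℝ => c p.1 p.2) (f := fun r : ℝ => ((0 : ℝ), r))
        (hc (0, t) hmem).continuousWithinAt (Continuous.continuousWithinAt (by fun_prop))
        (fun r hr => ⟨hs, hr⟩)
    exact h4.eventually ((chartAt E (Γ t).proj).open_source.mem_nhds hsrc)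
  refine (h2.congr_of_eventuallyEq_of_mem ?_ ht).congr_deriv ?_
  · filter_upwards [h3, self_mem_nhdsWithin] with r hr1 hr2
    exact variationMomentum_eq hF hab hc hs hr2 hr1 (snd_ne_zero_of_mem_unitBundle hF (hu r hr2))
  · simp only [ContinuousLinearMap.comp_apply, ContinuousLinearMap.inl_apply,
      ContinuousLinearMap.inr_apply]
    rw [← map_add]
    simp
    rfl

/-- Where a variation is constant in the parameter, its momentum vanishes. -/
theorem variationMomentum_eq_zero (hF : IsFinslerMetric F) (hab : a < b) (hε : 0 < ε)
    (hc : ContMDiffOn 𝓘(ℝ, ℝ × ℝ) 𝓘(ℝ, E) ∞ (fun p : ℝ × ℝ => c p.1 p.2)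
      (Ioo (-ε) ε ×ˢ Icc a b)) {t : ℝ} (ht : t ∈ Icc a b)
    (hv : (velocityLift (E := E) (c 0) (Icc a b) t).snd ≠ 0)
    (hconst : ∀ s ∈ Ioo (-ε) ε, c s t = c 0 t) : variationMomentum F c a b ε 0 t = 0 := by
  have hs : (0 : ℝ) ∈ Ioo (-ε) ε := ⟨by linarith, hε⟩
  set x₀ : TangentBundle 𝓘(ℝ, E) Q := velocityLift (c 0) (Icc a b) t with hx₀
  have hsrc : c 0 t ∈ (chartAt E x₀.proj).source := mem_chart_source E (c 0 t)
  rw [variationMomentum_eq hF hab hc hs ht hsrc hv]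
  have h1 := hasDerivAt_slice hs ht
    ((contDiffWithinAt_extChartAt_variation hc hs ht hsrc).differentiableWithinAt (by simp))
  have h2 : HasDerivAt (fun s => extChartAt 𝓘(ℝ, E) x₀.proj (c s t)) 0 0 := by
    refine (hasDerivAt_const (0 : ℝ) (extChartAt 𝓘(ℝ, E) x₀.proj (c 0 t))).congr_of_eventuallyEq ?_
    filter_upwards [isOpen_Ioo.mem_nhds hs] with s hs
    rw [hconst s hs]
  rw [h1.unique h2]
  exact map_zero _

/-- Unit speed solutions of the Euler-Lagrange equation are critical points of the length. -/
theorem hasDerivAt_finslerLength_zero (hF : IsFinslerMetric F) (hab : a < b) (hε : 0 < ε)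
    (hc : ContMDiffOn 𝓘(ℝ, ℝ × ℝ) 𝓘(ℝ, E) ∞ (fun p : ℝ × ℝ => c p.1 p.2)
      (Ioo (-ε) ε ×ˢ Icc a b))
    (hu : ∀ t ∈ Icc a b, velocityLift (c 0) (Icc a b) t ∈ unitBundle F)
    (hEL : ∀ t ∈ Icc a b, EulerLagrangeAt F (velocityLift (c 0) (Icc a b)) (Icc a b) t)
    (ha : ∀ s ∈ Ioo (-ε) ε, c s a = c 0 a) (hb : ∀ s ∈ Ioo (-ε) ε, c s b = c 0 b) :
    HasDerivAt (fun s => finslerLength F (c s) a b) 0 0 := by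
  have hs : (0 : ℝ) ∈ Ioo (-ε) ε := ⟨by linarith, hε⟩
  obtain ⟨hint, hder⟩ := hasDerivAt_integral_of_contDiffWithinAt
    (h := fun p : ℝ × ℝ => F (velocityLift (c p.1) (Icc a b) p.2)) hab hε fun t ht =>
    (contDiffWithinAt_speed_variation (x₀ := velocityLift (c 0) (Icc a b) t) hF hab hc hs ht
      (mem_chart_source E (c 0 t)) (snd_ne_zero_of_mem_unitBundle hF (hu t ht))).1.of_le
      ENat.LEInfty.out
  have hmom : ∀ t ∈ Icc a b, HasDerivWithinAt (variationMomentum F c a b ε 0)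
      (deriv (fun s => F (velocityLift (c s) (Icc a b) t)) 0) (Icc a b) t := fun t ht =>
    hasDerivWithinAt_variationMomentum hF hab hε hc hu ht (hEL t ht)
  have hFTC := intervalIntegral.integral_eq_sub_of_hasDerivAt_of_le hab.le
    (fun t ht => (hmom t ht).continuousWithinAt)
    (fun t ht => (hmom t (Ioo_subset_Icc_self ht)).hasDerivAt (Icc_mem_nhds ht.1 ht.2)) hint
  have hmem_a : a ∈ Icc a b := left_mem_Icc.2 hab.le
  have hmem_b : b ∈ Icc a b := right_mem_Icc.2 hab.le
  rw [variationMomentum_eq_zero hF hab hε hc hmem_a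
      (snd_ne_zero_of_mem_unitBundle hF (hu a hmem_a)) ha,
    variationMomentum_eq_zero hF hab hε hc hmem_b
      (snd_ne_zero_of_mem_unitBundle hF (hu b hmem_b)) hb, sub_zero] at hFTC
  exact hder.congr_deriv hFTC

end Variations

/-! ### Reeb orbits project to geodesics -/

section IntegralCurves

/-- Solutions of a smooth ordinary differential equation are smooth. -/
theorem contDiffOn_of_hasDerivWithinAt {W : Type*} [NormedAddCommGroup W] [NormedSpace ℝ W]
    {X : W → W} {y : ℝ → W} {K : Set ℝ} (hK : UniqueDiffOn ℝ K)
    (hX : ∀ t ∈ K, ContDiffAt ℝ ∞ X (y t))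
    (hy : ∀ t ∈ K, HasDerivWithinAt y (X (y t)) K t) : ContDiffOn ℝ ∞ y K := by
  rw [contDiffOn_infty]
  intro n
  induction n with
  | zero =>
    exact contDiffOn_zero.2 fun t ht => (hy t ht).continuousWithinAt
  | succ n ih =>
    rw [Nat.cast_add, Nat.cast_one, contDiffOn_succ_iff_derivWithin hK]
    refine ⟨fun t ht => (hy t ht).differentiableWithinAt, by simp, ?_⟩
    have h1 : ContDiffOn ℝ n (fun t => X (y t)) K := fun t ht =>
      ((hX t ht).of_le (by exact_mod_cast le_top)).comp_contDiffWithinAt t (ih t ht)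
    exact h1.congr fun t ht => (hy t ht).derivWithin (hK t ht)

/-- The geodesic equation for `G = L² / 2` implies the Euler-Lagrange equation for `L` along curves
with `L = 1`, where the derivatives of `G` and `L` agree. -/
theorem IsLocalFinsler.hasDerivWithinAt_fderiv_comp_inr {E : Type*} [NormedAddCommGroup E]
    [NormedSpace ℝ E] {V : Set E} {L : E × E → ℝ} (h : IsLocalFinsler V L) {y : ℝ → E × E}
    {J : Set ℝ} {t : ℝ} (ht : t ∈ J) {z : E × E} (hy : HasDerivWithinAt y z J t)
    (hu : ∀ᶠ s in 𝓝[J] t, (y s).1 ∈ V ∧ (y s).2 ≠ 0 ∧ L (y s) = 1)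
    (hz : ∀ ξ, fderiv ℝ (fderiv ℝ (localEnergy L)) (y t) z (0, ξ) =
      fderiv ℝ (localEnergy L) (y t) (ξ, 0)) :
    HasDerivWithinAt (fun s => (fderiv ℝ L (y s)).comp (ContinuousLinearMap.inr ℝ E E))
      ((fderiv ℝ L (y t)).comp (ContinuousLinearMap.inl ℝ E E)) J t := by
  have hfd : ∀ᶠ s in 𝓝[J] t, fderiv ℝ L (y s) = fderiv ℝ (localEnergy L) (y s) := by
    filter_upwards [hu] with s hs
    rw [h.fderiv_energy hs.1 hs.2.1, hs.2.2, one_smul]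
  obtain ⟨hp, hv, -⟩ := hu.self_of_nhdsWithin ht
  have h2 := ((h.differentiableAt_fderiv_energy hp hv).hasFDerivAt.comp_hasDerivWithinAt t
    hy).clm_comp (hasDerivWithinAt_const t J (ContinuousLinearMap.inr ℝ E E))
  refine (h2.congr_of_eventuallyEq_of_mem ?_ ht).congr_deriv ?_
  · filter_upwards [hfd] with s hs
    rw [hs, Function.comp_apply]
  · rw [hfd.self_of_nhdsWithin ht]
    ext ξ
    simpa using hz ξ

variable {E : Type*} [NormedAddCommGroup E] [NormedSpace ℝ E]
  {Q : Type*} [TopologicalSpace Q] [ChartedSpace E Q] [IsManifold 𝓘(ℝ, E) ∞ Q]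
  {F : TangentBundle 𝓘(ℝ, E) Q → ℝ}

theorem EulerLagrangeAt.congr_mono {Γ Γ' : ℝ → TangentBundle 𝓘(ℝ, E) Q} {J K : Set ℝ} {t : ℝ}
    (h : EulerLagrangeAt F Γ J t) (hKJ : K ⊆ J) (heq : EqOn Γ' Γ K) (ht : t ∈ K) :
    EulerLagrangeAt F Γ' K t := by
  unfold EulerLagrangeAt at h ⊢
  rw [heq ht]
  exact (h.mono hKJ).congr (fun s hs => by rw [heq hs]) (by rw [heq ht])

theorem eulerLagrangeAt_of_hasDerivWithinAt (hF : IsFinslerMetric F)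
    {Γ : ℝ → TangentBundle 𝓘(ℝ, E) Q} {J : Set ℝ} {t : ℝ} (ht : t ∈ J)
    (hu : ∀ t ∈ J, Γ t ∈ unitBundle F) (hΓ : ContinuousWithinAt Γ J t) {z : E × E}
    (hy : HasDerivWithinAt (fun s => extChartAt 𝓘(ℝ, E).tangent (Γ t) (Γ s)) z J t)
    (hz : ∀ ξ, fderiv ℝ (fderiv ℝ (localEnergy (localMetric F (Γ t))))
        (extChartAt 𝓘(ℝ, E).tangent (Γ t) (Γ t)) z (0, ξ) =
      fderiv ℝ (localEnergy (localMetric F (Γ t))) (extChartAt 𝓘(ℝ, E).tangent (Γ t) (Γ t))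
        (ξ, 0)) : EulerLagrangeAt F Γ J t := by
  refine (isLocalFinsler_localMetric hF (Γ t)).hasDerivWithinAt_fderiv_comp_inr ht hy ?_ hz
  filter_upwards [hΓ ((isOpen_extChartAt_source (I := 𝓘(ℝ, E).tangent) (Γ t)).mem_nhds
    (mem_extChartAt_source (Γ t))), self_mem_nhdsWithin] with s hs1 hs2
  have hs := mem_extChartAt_tangent_source.1 hs1
  exact ⟨mem_target_of_mem_source hs, (extChartAt_tangent_snd_ne_zero hs).2
    (snd_ne_zero_of_mem_unitBundle hF (hu s hs2)), localMetric_eq_one hs (hu s hs2)⟩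

/-- The geodesic spray of `L`, as a vector field on `E × E`. -/
noncomputable def localSpray (L : E × E → ℝ) (z : E × E) : E × E :=
  (z.2, geodesicAcceleration L z)

theorem continuousOn_of_isMIntegralCurveOn
    {R : (x : TangentBundle 𝓘(ℝ, E) Q) → TangentSpace 𝓘(ℝ, E).tangent x}
    {Γ : ℝ → TangentBundle 𝓘(ℝ, E) Q} {J : Set ℝ}
    (hΓ : IsMIntegralCurveOn (I := 𝓘(ℝ, E).tangent) Γ R J) : ContinuousOn Γ J :=
  fun t ht => (hΓ t ht).continuousWithinAt

variable [FiniteDimensional ℝ E]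

theorem hasDerivWithinAt_of_isMIntegralCurveOn (hF : IsFinslerMetric F)
    {R : (x : TangentBundle 𝓘(ℝ, E) Q) → TangentSpace 𝓘(ℝ, E).tangent x}
    (hR : IsReebVectorField F R) {Γ : ℝ → TangentBundle 𝓘(ℝ, E) Q} {J : Set ℝ}
    (hu : ∀ t ∈ J, Γ t ∈ unitBundle F)
    (hΓ : IsMIntegralCurveOn (I := 𝓘(ℝ, E).tangent) Γ R J) {x₀ : TangentBundle 𝓘(ℝ, E) Q}
    {t : ℝ} (ht : t ∈ J) (hx : (Γ t).proj ∈ (chartAt E x₀.proj).source) :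
    HasDerivWithinAt (fun s => extChartAt 𝓘(ℝ, E).tangent x₀ (Γ s))
      (localSpray (localMetric F x₀) (extChartAt 𝓘(ℝ, E).tangent x₀ (Γ t))) J t :=
  (hasDerivWithinAt_extChartAt_tangent hx (hΓ t ht)).congr_deriv
    ((isReebVector_iff_geodesicAcceleration hF hx (hu t ht) _).1 (hR _ (hu t ht)))

theorem contDiffWithinAt_of_isMIntegralCurveOn (hF : IsFinslerMetric F)
    {R : (x : TangentBundle 𝓘(ℝ, E) Q) → TangentSpace 𝓘(ℝ, E).tangent x}
    (hR : IsReebVectorField F R) {Γ : ℝ → TangentBundle 𝓘(ℝ, E) Q} {J : Set ℝ}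
    (hJ : UniqueDiffOn ℝ J) (hu : ∀ t ∈ J, Γ t ∈ unitBundle F)
    (hΓ : IsMIntegralCurveOn (I := 𝓘(ℝ, E).tangent) Γ R J) {x₀ : TangentBundle 𝓘(ℝ, E) Q}
    {t : ℝ} (ht : t ∈ J) (hx : (Γ t).proj ∈ (chartAt E x₀.proj).source) :
    ContDiffWithinAt ℝ ∞ (fun s => extChartAt 𝓘(ℝ, E).tangent x₀ (Γ s)) J t := by
  obtain ⟨U, hU, hUJ⟩ := continuousOn_iff'.1 (continuousOn_of_isMIntegralCurveOn hΓ) _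
    (isOpen_extChartAt_source (I := 𝓘(ℝ, E).tangent) x₀)
  have hmem {s : ℝ} (hs : s ∈ J ∩ U) : (Γ s).proj ∈ (chartAt E x₀.proj).source := by
    have : s ∈ U ∩ J := hs.symm
    rw [← hUJ] at this
    exact mem_extChartAt_tangent_source.1 this.1
  have htU : t ∈ U := by
    have : t ∈ U ∩ J := by
      rw [← hUJ]
      exact ⟨mem_extChartAt_tangent_source.2 hx, ht⟩
    exact this.1
  have hsm : ContDiffOn ℝ ∞ (fun s => extChartAt 𝓘(ℝ, E).tangent x₀ (Γ s)) (J ∩ U) := by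
    refine contDiffOn_of_hasDerivWithinAt (X := localSpray (localMetric F x₀)) (hJ.inter hU) ?_ ?_
    · intro s hs
      refine contDiffAt_snd.prodMk ?_
      exact (isLocalFinsler_localMetric hF x₀).contDiffAt_geodesicAcceleration
        (mem_target_of_mem_source (hmem hs)) ((extChartAt_tangent_snd_ne_zero (hmem hs)).2
          (snd_ne_zero_of_mem_unitBundle hF (hu s hs.1)))
    · intro s hs
      exact (hasDerivWithinAt_of_isMIntegralCurveOn hF hR hu hΓ hs.1 (hmem hs)).mono
        inter_subset_left
  exact (contDiffWithinAt_inter (hU.mem_nhds htU)).1 (hsm t ⟨ht, htU⟩)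

/-- The projection of an integral curve is smooth, because the Reeb vector field is. -/
theorem contMDiffOn_proj_of_isMIntegralCurveOn (hF : IsFinslerMetric F)
    {R : (x : TangentBundle 𝓘(ℝ, E) Q) → TangentSpace 𝓘(ℝ, E).tangent x}
    (hR : IsReebVectorField F R) {Γ : ℝ → TangentBundle 𝓘(ℝ, E) Q} {J : Set ℝ}
    (hJ : UniqueDiffOn ℝ J) (hu : ∀ t ∈ J, Γ t ∈ unitBundle F)
    (hΓ : IsMIntegralCurveOn (I := 𝓘(ℝ, E).tangent) Γ R J) :
    ContMDiffOn 𝓘(ℝ, ℝ) 𝓘(ℝ, E) ∞ (fun t => (Γ t).proj) J := by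
  intro t ht
  rw [contMDiffWithinAt_iff_target]
  constructor
  · exact (FiberBundle.continuous_proj E
      (TangentSpace 𝓘(ℝ, E))).continuousAt.comp_continuousWithinAt (continuousOn_of_isMIntegralCurveOn hΓ t ht)
  · rw [contMDiffWithinAt_iff_contDiffWithinAt]
    exact contDiffAt_fst.comp_contDiffWithinAt t (contDiffWithinAt_of_isMIntegralCurveOn hF hR hJ hu
      hΓ (x₀ := Γ t) ht (mem_chart_source E _))

/-- The Reeb vector field is a second order equation: its integral curves are velocity curves. -/
theorem velocityLift_proj_of_isMIntegralCurveOn (hF : IsFinslerMetric F)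
    {R : (x : TangentBundle 𝓘(ℝ, E) Q) → TangentSpace 𝓘(ℝ, E).tangent x}
    (hR : IsReebVectorField F R) {Γ : ℝ → TangentBundle 𝓘(ℝ, E) Q} {J : Set ℝ}
    (hJ : UniqueDiffOn ℝ J) (hu : ∀ t ∈ J, Γ t ∈ unitBundle F)
    (hΓ : IsMIntegralCurveOn (I := 𝓘(ℝ, E).tangent) Γ R J) {t : ℝ} (ht : t ∈ J) :
    velocityLift (fun t => (Γ t).proj) J t = Γ t := by
  have hsrc : (Γ t).proj ∈ (chartAt E (Γ t).proj).source := mem_chart_source E _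
  have h1 := extChartAt_velocityLift (x₀ := Γ t) (γ := fun t => (Γ t).proj) hsrc (hJ t ht)
    ((contMDiffOn_proj_of_isMIntegralCurveOn hF hR hJ hu hΓ t ht).mdifferentiableWithinAt (by simp))
  have h2 := hasDerivWithinAt_of_isMIntegralCurveOn hF hR hu hΓ (x₀ := Γ t) ht hsrc
  have h3 := (hasFDerivAt_fst (𝕜 := ℝ) (E := E) (F := E)).comp_hasDerivWithinAt t h2
  have h4 : derivWithin (fun s => extChartAt 𝓘(ℝ, E) (Γ t).proj (Γ s).proj) J t =
      (extChartAt 𝓘(ℝ, E).tangent (Γ t) (Γ t)).2 := h3.derivWithin (hJ t ht)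
  rw [h4] at h1
  exact (extChartAt 𝓘(ℝ, E).tangent (Γ t)).injOn
    (show velocityLift (fun t => (Γ t).proj) J t ∈ _ from mem_extChartAt_tangent_source.2 hsrc)
    (mem_extChartAt_tangent_source.2 hsrc) h1

theorem isUnitSpeedGeodesic_of_isMIntegralCurveOn (hF : IsFinslerMetric F)
    {R : (x : TangentBundle 𝓘(ℝ, E) Q) → TangentSpace 𝓘(ℝ, E).tangent x}
    (hR : IsReebVectorField F R) {Γ : ℝ → TangentBundle 𝓘(ℝ, E) Q} {J : Set ℝ}
    (hJ : UniqueDiffOn ℝ J) (hu : ∀ t ∈ J, Γ t ∈ unitBundle F)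
    (hΓ : IsMIntegralCurveOn (I := 𝓘(ℝ, E).tangent) Γ R J) {γ : ℝ → Q}
    (hγ : ∀ t ∈ J, (Γ t).proj = γ t) : IsUnitSpeedGeodesic F γ J := by
  have hsm := contMDiffOn_proj_of_isMIntegralCurveOn hF hR hJ hu hΓ
  have hvel {γ' : ℝ → Q} {K : Set ℝ} (hKJ : K ⊆ J) (hK : UniqueDiffOn ℝ K)
      (h : ∀ t ∈ K, γ' t = γ t) : EqOn (velocityLift γ' K) Γ K := by
    intro t ht
    rw [← velocityLift_proj_of_isMIntegralCurveOn hF hR hJ hu hΓ (hKJ ht)]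
    exact velocityLift_eq_of_eqOn hKJ (fun s hs => (h s hs).trans (hγ s (hKJ hs)).symm) ht (hK t ht)
      ((hsm t (hKJ ht)).mdifferentiableWithinAt (by simp))
  refine ⟨hsm.congr fun t ht => (hγ t ht).symm, fun t ht => ?_, ?_⟩
  · rw [hvel Subset.rfl hJ (fun _ _ => rfl) ht]
    exact hu t ht
  · intro a b hab hIJ ε c hc
    have hv := hvel hIJ (uniqueDiffOn_Icc hab) hc.zero
    have hz : (0 : ℝ) ∈ Ioo (-ε) ε := ⟨by linarith [hc.pos], hc.pos⟩
    obtain ⟨δ, hδ, hfix⟩ := hc.fixed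
    have hmem_a : a ∈ Icc a b := left_mem_Icc.2 hab.le
    have hmem_b : b ∈ Icc a b := right_mem_Icc.2 hab.le
    refine hasDerivAt_finslerLength_zero hF hab hc.pos hc.smooth (fun t ht => ?_) (fun t ht => ?_)
      (fun s hs => ?_) (fun s hs => ?_)
    · rw [hv ht]
      exact hu t (hIJ ht)
    · refine EulerLagrangeAt.congr_mono (Γ := Γ) (J := J) ?_ hIJ hv ht
      have hsrc : (Γ t).proj ∈ (chartAt E (Γ t).proj).source := mem_chart_source E _
      refine eulerLagrangeAt_of_hasDerivWithinAt hF (hIJ ht) hu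
        (continuousOn_of_isMIntegralCurveOn hΓ t (hIJ ht))
        (hasDerivWithinAt_of_isMIntegralCurveOn hF hR hu hΓ (hIJ ht) hsrc) ?_
      exact ((isLocalFinsler_localMetric hF (Γ t)).geodesicAcceleration_eq_iff
        (mem_target_of_mem_source hsrc) ((extChartAt_tangent_snd_ne_zero hsrc).2
          (snd_ne_zero_of_mem_unitBundle hF (hu t (hIJ ht)))) _).1 rfl
    · rw [hfix s hs a hmem_a (Or.inl (by linarith)), hc.zero a hmem_a]
    · rw [hfix s hs b hmem_b (Or.inr (by linarith)), hc.zero b hmem_b]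

end IntegralCurves

/-! ### The Euler-Lagrange equation of critical curves -/

section EulerLagrange

/-- The du Bois-Reymond form of the fundamental lemma of the calculus of variations. -/
theorem eqOn_of_integral_testFunction_eq_zero {a b : ℝ} (hab : a < b) {p g g' : ℝ → ℝ}
    (hp : ContinuousOn p (Icc a b)) (hg' : ContinuousOn g' (Icc a b))
    (hg : ∀ t ∈ Icc a b, HasDerivWithinAt g (g' t) (Icc a b) t)
    (h : ∀ η : ℝ → ℝ, ContDiff ℝ ∞ η → HasCompactSupport η → tsupport η ⊆ Ioo a b →
      ∫ t in a..b, (η t * p t + deriv η t * g t) = 0) : EqOn g' p (Ioo a b) := by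
  have hgc : ContinuousOn g (Icc a b) := fun t ht => (hg t ht).continuousWithinAt
  have hIcc : Icc a b = uIcc a b := (uIcc_of_le hab.le).symm
  have hf : ContinuousOn (fun t => p t - g' t) (Icc a b) := hp.sub hg'
  have hae := isOpen_Ioo.ae_eq_zero_of_integral_contDiff_smul_eq_zero
    (μ := MeasureTheory.volume) (U := Ioo a b) (f := fun t => p t - g' t)
    ((hf.mono Ioo_subset_Icc_self).locallyIntegrableOn measurableSet_Ioo) ?_
  · have h0 : EqOn (fun t => p t - g' t) (fun _ => 0) (Ioo a b) :=
      MeasureTheory.Measure.eqOn_open_of_ae_eq (μ := MeasureTheory.volume)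
        ((MeasureTheory.ae_restrict_iff' measurableSet_Ioo).2 hae) isOpen_Ioo
        (hf.mono Ioo_subset_Icc_self) continuousOn_const
    intro t ht
    have := h0 ht
    simp only at this
    linarith
  · intro η hη hηc hηs
    have hηd : Continuous (deriv η) := hη.continuous_deriv (by simp)
    have hout {t : ℝ} (ht : t ∉ Ioo a b) : η t = 0 :=
      image_eq_zero_of_notMem_tsupport fun h' => ht (hηs h')
    have h1 : ∫ t, η t • (p t - g' t) = ∫ t in a..b, η t * (p t - g' t) := by
      refine (intervalIntegral.integral_eq_integral_of_support_subset ?_).symm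
      intro t ht
      by_contra hne
      exact ht (by simp [hout fun h' => hne (Ioo_subset_Ioc_self h')])
    have h2 : ∫ t in a..b, (deriv η t * g t + η t * g' t) = η b * g b - η a * g a := by
      refine intervalIntegral.integral_eq_sub_of_hasDerivAt_of_le (f := fun t => η t * g t) hab.le
        (hη.continuous.continuousOn.mul hgc) (fun t ht => ?_) ?_
      · exact (hη.differentiable (by simp) t).hasDerivAt.mul
          ((hg t (Ioo_subset_Icc_self ht)).hasDerivAt (Icc_mem_nhds ht.1 ht.2))
      · exact ((hηd.continuousOn.mul hgc).add
          (hη.continuous.continuousOn.mul hg')).mono hIcc.ge |>.intervalIntegrable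
    have h3 := h η hη hηc hηs
    rw [hout (by simp), hout (by simp)] at h2
    have hi1 : IntervalIntegrable (fun t => η t * p t + deriv η t * g t)
        MeasureTheory.volume a b :=
      ((hη.continuous.continuousOn.mul hp).add
        (hηd.continuousOn.mul hgc)).mono hIcc.ge |>.intervalIntegrable
    have hi2 : IntervalIntegrable (fun t => deriv η t * g t + η t * g' t)
        MeasureTheory.volume a b :=
      ((hηd.continuousOn.mul hgc).add
        (hη.continuous.continuousOn.mul hg')).mono hIcc.ge |>.intervalIntegrable
    have h4 := intervalIntegral.integral_sub hi1 hi2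
    rw [h2, h3] at h4
    rw [h1]
    refine (intervalIntegral.integral_congr fun t _ => ?_).trans (h4.trans (by ring))
    ring

variable {E : Type*} [NormedAddCommGroup E] [NormedSpace ℝ E]

/-- A small perturbation of a curve contained in an open set remains in this set. -/
theorem exists_pos_forall_add_smul_mem {a b : ℝ} {V : Set E} (hV : IsOpen V) {u w : ℝ → E}
    (hu : ContinuousOn u (Icc a b)) (hw : Continuous w) (huV : ∀ t ∈ Icc a b, u t ∈ V) :
    ∃ ε : ℝ, 0 < ε ∧ ∀ s ∈ Ioo (-ε) ε, ∀ t ∈ Icc a b, u t + s • w t ∈ V := by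
  have h1 : ∀ᶠ s in 𝓝 (0 : ℝ), ∀ t ∈ Icc a b, t ∈ Icc a b → u t + s • w t ∈ V := by
    refine isCompact_Icc.eventually_forall_of_forall_eventually fun t ht => ?_
    have h2 : ContinuousWithinAt (fun z : ℝ × ℝ => u z.2 + z.1 • w z.2) (univ ×ˢ Icc a b)
        (0, t) := by
      refine ContinuousWithinAt.add ?_ (Continuous.continuousWithinAt (by fun_prop))
      exact ContinuousWithinAt.comp (f := fun z : ℝ × ℝ => z.2) (hu t ht)
        continuous_snd.continuousWithinAt (fun z hz => hz.2)
    have h3 := h2.eventually (hV.mem_nhds (by simpa using huV t ht))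
    rw [eventually_nhdsWithin_iff] at h3
    filter_upwards [h3] with z hz hz2
    exact hz ⟨mem_univ _, hz2⟩
  obtain ⟨ε, hε, h⟩ := Metric.eventually_nhds_iff.1 h1
  refine ⟨ε, hε, fun s hs t ht => h ?_ t ht ht⟩
  rw [Real.dist_eq, sub_zero, abs_lt]
  exact hs

namespace IsLocalFinsler

variable {V : Set E} {L : E × E → ℝ} (h : IsLocalFinsler V L)
include h

/-- The first variation of the length in the direction of `w`. -/
theorem hasDerivAt_integral_add_smul {a b : ℝ} (hab : a < b) {u v w w' : ℝ → E}
    (hu : ContDiffOn ℝ ∞ u (Icc a b)) (hv : ContDiffOn ℝ ∞ v (Icc a b)) (hw : ContDiff ℝ ∞ w)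
    (hw' : ContDiff ℝ ∞ w') (huV : ∀ t ∈ Icc a b, u t ∈ V) (hv0 : ∀ t ∈ Icc a b, v t ≠ 0) :
    HasDerivAt (fun s : ℝ => ∫ t in a..b, L (u t + s • w t, v t + s • w' t))
      (∫ t in a..b, fderiv ℝ L (u t, v t) (w t, w' t)) 0 := by
  have hsm : ∀ t ∈ Icc a b, ContDiffWithinAt ℝ 1
      (fun p : ℝ × ℝ => L (u p.2 + p.1 • w p.2, v p.2 + p.1 • w' p.2))
      (Ioo (-1) 1 ×ˢ Icc a b) (0, t) := by
    intro t ht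
    have hmaps : MapsTo (Prod.snd : ℝ × ℝ → ℝ) (Ioo (-1) 1 ×ˢ Icc a b) (Icc a b) :=
      fun p hp => hp.2
    have h1 {f g : ℝ → E} (hf : ContDiffOn ℝ ∞ f (Icc a b)) (hg : ContDiff ℝ ∞ g) :
        ContDiffWithinAt ℝ ∞ (fun p : ℝ × ℝ => f p.2 + p.1 • g p.2)
          (Ioo (-1) 1 ×ˢ Icc a b) (0, t) := by
      refine ContDiffWithinAt.add ?_ (contDiff_fst.smul (hg.comp contDiff_snd)).contDiffWithinAt
      exact ContDiffWithinAt.comp (f := Prod.snd) (0, t) (hf t ht) contDiffWithinAt_snd hmaps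
    refine ContDiffWithinAt.of_le ?_ (n := ∞) ENat.LEInfty.out
    refine ContDiffAt.comp_contDiffWithinAt (g := L)
      (f := fun p : ℝ × ℝ => (u p.2 + p.1 • w p.2, v p.2 + p.1 • w' p.2)) (0, t) ?_
      ((h1 hu hw).prodMk (h1 hv hw'))
    simpa using h.contDiffAt (y := (u t, v t)) (huV t ht) (hv0 t ht)
  have h2 := (hasDerivAt_integral_of_contDiffWithinAt hab one_pos hsm).2
  refine h2.congr_deriv (intervalIntegral.integral_congr fun t ht => ?_)
  rw [uIcc_of_le hab.le] at ht
  refine HasDerivAt.deriv ?_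
  have h3 : HasDerivAt (fun s : ℝ => (u t + s • w t, v t + s • w' t)) (w t, w' t) 0 := by
    have h4 (x y : E) : HasDerivAt (fun s : ℝ => x + s • y) y 0 := by
      simpa using ((hasDerivAt_id (0 : ℝ)).smul_const y).const_add x
    exact (h4 _ _).prodMk (h4 _ _)
  have h5 := (h.differentiableAt (y := (u t, v t)) (huV t ht) (hv0 t ht)).hasFDerivAt
  refine HasFDerivAt.comp_hasDerivAt (l := L)
    (f := fun s : ℝ => (u t + s • w t, v t + s • w' t)) 0 ?_ h3
  simpa using h5

/-- The Euler-Lagrange equation of a curve `y = (u, v)` in `V × E` on which `L` is constant equal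
to `1`, on which the first variation of the length vanishes. -/
theorem derivWithin_fderiv_energy_eq {a b : ℝ} (hab : a < b) {y : ℝ → E × E}
    (hy : ContDiffOn ℝ ∞ y (Icc a b)) (hyV : ∀ t ∈ Icc a b, (y t).1 ∈ V)
    (hy0 : ∀ t ∈ Icc a b, (y t).2 ≠ 0) (hunit : ∀ t ∈ Icc a b, L (y t) = 1) {ξ : E}
    (hcrit : ∀ η : ℝ → ℝ, ContDiff ℝ ∞ η → tsupport η ⊆ Ioo a b →
      ∫ t in a..b, fderiv ℝ L (y t) (η t • ξ, deriv η t • ξ) = 0) {t : ℝ} (ht : t ∈ Ioo a b) :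
    derivWithin (fun t => fderiv ℝ (localEnergy L) (y t) (0, ξ)) (Icc a b) t =
      fderiv ℝ (localEnergy L) (y t) (ξ, 0) := by
  have hDc (ζ : E × E) : ContDiffOn ℝ ∞ (fun t => fderiv ℝ (localEnergy L) (y t) ζ)
      (Icc a b) := fun t ht =>
    ((h.contDiffAt_fderiv_energy (hyV t ht) (hy0 t ht)).comp_contDiffWithinAt t
      (hy t ht)).clm_apply contDiffWithinAt_const
  refine eqOn_of_integral_testFunction_eq_zero hab (hDc _).continuousOn
    ((hDc (0, ξ)).continuousOn_derivWithin (uniqueDiffOn_Icc hab) (by simp))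
    (fun t ht => ((hDc _).differentiableOn (by simp) t ht).hasDerivWithinAt)
    (fun η hη _ hηs => ?_) ht
  rw [← hcrit η hη hηs]
  refine intervalIntegral.integral_congr fun t ht => ?_
  rw [uIcc_of_le hab.le] at ht
  have hfd : fderiv ℝ (localEnergy L) (y t) = fderiv ℝ L (y t) := by
    rw [h.fderiv_energy (hyV t ht) (hy0 t ht), hunit t ht, one_smul]
  have hsplit : ((η t • ξ, deriv η t • ξ) : E × E) = η t • (ξ, 0) + deriv η t • (0, ξ) := by
    simp
  rw [hsplit, map_add, map_smul, map_smul, hfd, smul_eq_mul, smul_eq_mul]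

/-- A unit speed curve on which the first variation of the length vanishes satisfies the geodesic
equation. -/
theorem derivWithin_snd_eq_geodesicAcceleration [FiniteDimensional ℝ E] {a b : ℝ} (hab : a < b)
    {y : ℝ → E × E} (hy : ContDiffOn ℝ ∞ y (Icc a b)) (hyV : ∀ t ∈ Icc a b, (y t).1 ∈ V)
    (hy0 : ∀ t ∈ Icc a b, (y t).2 ≠ 0) (hunit : ∀ t ∈ Icc a b, L (y t) = 1)
    (hcrit : ∀ (ξ : E) (η : ℝ → ℝ), ContDiff ℝ ∞ η → tsupport η ⊆ Ioo a b →
      ∫ t in a..b, fderiv ℝ L (y t) (η t • ξ, deriv η t • ξ) = 0) {t : ℝ} (ht : t ∈ Ioo a b)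
    {w : E} (hw : HasDerivWithinAt y ((y t).2, w) (Icc a b) t) :
    w = geodesicAcceleration L (y t) := by
  have htI := Ioo_subset_Icc_self ht
  rw [h.geodesicAcceleration_eq_iff (hyV t htI) (hy0 t htI)]
  intro ξ
  rw [← h.derivWithin_fderiv_energy_eq hab hy hyV hy0 hunit (hcrit ξ) ht]
  have h2 := ((h.differentiableAt_fderiv_energy (hyV t htI)
    (hy0 t htI)).hasFDerivAt.comp_hasDerivWithinAt t hw).clm_apply
    (hasDerivWithinAt_const t (Icc a b) ((0, ξ) : E × E))
  rw [map_zero, add_zero] at h2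
  exact (h2.derivWithin (uniqueDiffOn_Icc hab t htI)).symm

end IsLocalFinsler

end EulerLagrange

/-! ### Geodesics lift to Reeb orbits -/

section Geodesics

variable {E : Type*} [NormedAddCommGroup E] [NormedSpace ℝ E]
  {Q : Type*} [TopologicalSpace Q] [ChartedSpace E Q] {γ : ℝ → Q} {J : Set ℝ}

theorem eventually_mem_chart_source (hγ : ContMDiffOn 𝓘(ℝ, ℝ) 𝓘(ℝ, E) ∞ γ J) {q₀ : Q}
    {t : ℝ} (ht : t ∈ J) (hx : γ t ∈ (chartAt E q₀).source) :
    ∀ᶠ s in 𝓝[J] t, γ s ∈ (chartAt E q₀).source :=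
  (hγ t ht).continuousWithinAt.eventually ((chartAt E q₀).open_source.mem_nhds hx)

variable [IsManifold 𝓘(ℝ, E) ∞ Q] {F : TangentBundle 𝓘(ℝ, E) Q → ℝ}

theorem contDiffWithinAt_extChartAt_curve (hγ : ContMDiffOn 𝓘(ℝ, ℝ) 𝓘(ℝ, E) ∞ γ J) {q₀ : Q}
    {t : ℝ} (ht : t ∈ J) (hx : γ t ∈ (chartAt E q₀).source) :
    ContDiffWithinAt ℝ ∞ (fun s => extChartAt 𝓘(ℝ, E) q₀ (γ s)) J t := by
  rw [← contMDiffWithinAt_iff_contDiffWithinAt]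
  exact (contMDiffAt_extChartAt' (n := ∞) (x' := γ t) hx).comp_contMDiffWithinAt t (hγ t ht)

/-- The velocity curve of a smooth curve is smooth, in a chart. -/
theorem contDiffWithinAt_extChartAt_velocityLift (hJ : UniqueDiffOn ℝ J)
    (hγ : ContMDiffOn 𝓘(ℝ, ℝ) 𝓘(ℝ, E) ∞ γ J) {x₀ : TangentBundle 𝓘(ℝ, E) Q}
    {t : ℝ} (ht : t ∈ J) (hx : γ t ∈ (chartAt E x₀.proj).source) :
    ContDiffWithinAt ℝ ∞ (fun s => extChartAt 𝓘(ℝ, E).tangent x₀ (velocityLift γ J s)) J t := by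
  have hu := contDiffWithinAt_extChartAt_curve hγ ht hx
  have hv : ContDiffWithinAt ℝ ∞
      (derivWithin (fun s => extChartAt 𝓘(ℝ, E) x₀.proj (γ s)) J) J t :=
    (hu.fderivWithin_right hJ (m := ∞) (by simp) ht).clm_apply contDiffWithinAt_const
  refine (hu.prodMk hv).congr_of_eventuallyEq_of_mem ?_ ht
  filter_upwards [eventually_mem_chart_source hγ ht hx, self_mem_nhdsWithin] with s hs1 hs2
  exact extChartAt_velocityLift hs1 (hJ s hs2) ((hγ s hs2).mdifferentiableWithinAt (by simp))

theorem hasDerivWithinAt_extChartAt_velocityLift (hJ : UniqueDiffOn ℝ J)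
    (hγ : ContMDiffOn 𝓘(ℝ, ℝ) 𝓘(ℝ, E) ∞ γ J) {x₀ : TangentBundle 𝓘(ℝ, E) Q}
    {t : ℝ} (ht : t ∈ J) (hx : γ t ∈ (chartAt E x₀.proj).source) :
    HasDerivWithinAt (fun s => extChartAt 𝓘(ℝ, E).tangent x₀ (velocityLift γ J s))
      ((extChartAt 𝓘(ℝ, E).tangent x₀ (velocityLift γ J t)).2,
        (derivWithin (fun s => extChartAt 𝓘(ℝ, E).tangent x₀ (velocityLift γ J s)) J t).2) J t := by
  have h1 := ((contDiffWithinAt_extChartAt_velocityLift hJ hγ ht hx).differentiableWithinAt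
    (by simp)).hasDerivWithinAt
  refine h1.congr_deriv (Prod.ext ?_ rfl)
  have h2 := (hasFDerivAt_fst (𝕜 := ℝ) (E := E) (F := E)).comp_hasDerivWithinAt t h1
  rw [extChartAt_velocityLift hx (hJ t ht) ((hγ t ht).mdifferentiableWithinAt (by simp))]
  exact (h2.derivWithin (hJ t ht)).symm

/-- The variation of a curve in a chart domain by `s • w`, where `w` vanishes near the end
points. -/
theorem isVariation_extChartAt_symm {a b ε : ℝ} {x₀ : Q}
    (hγ : ContMDiffOn 𝓘(ℝ, ℝ) 𝓘(ℝ, E) ∞ γ (Icc a b))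
    (hx : ∀ t ∈ Icc a b, γ t ∈ (chartAt E x₀).source) {w : ℝ → E} (hw : ContDiff ℝ ∞ w)
    (hws : tsupport w ⊆ Ioo a b) (hε : 0 < ε)
    (hmem : ∀ s ∈ Ioo (-ε) ε, ∀ t ∈ Icc a b,
      extChartAt 𝓘(ℝ, E) x₀ (γ t) + s • w t ∈ (extChartAt 𝓘(ℝ, E) x₀).target) :
    IsVariation (E := E) γ a b ε fun s t =>
      (extChartAt 𝓘(ℝ, E) x₀).symm (extChartAt 𝓘(ℝ, E) x₀ (γ t) + s • w t) := by
  have hinv (t : ℝ) (ht : t ∈ Icc a b) :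
      (extChartAt 𝓘(ℝ, E) x₀).symm (extChartAt 𝓘(ℝ, E) x₀ (γ t)) = γ t :=
    (extChartAt 𝓘(ℝ, E) x₀).left_inv (by simpa using hx t ht)
  refine ⟨hε, ?_, ?_, ?_⟩
  · refine (contMDiffOn_extChartAt_symm x₀).comp (t := (extChartAt 𝓘(ℝ, E) x₀).target)
      (f := fun p : ℝ × ℝ => extChartAt 𝓘(ℝ, E) x₀ (γ p.2) + p.1 • w p.2) ?_
      (fun p hp => hmem p.1 hp.1 p.2 hp.2)
    rw [contMDiffOn_iff_contDiffOn]
    refine ContDiffOn.add ?_ (contDiff_fst.smul (hw.comp contDiff_snd)).contDiffOn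
    exact ContDiffOn.comp (f := Prod.snd) (t := Icc a b)
      (fun t ht => contDiffWithinAt_extChartAt_curve hγ ht (hx t ht)) contDiffOn_snd
      (fun p hp => hp.2)
  · intro t ht
    simp only [zero_smul, add_zero]
    exact hinv t ht
  · have hnear (x : ℝ) (hxs : x ∉ Ioo a b) : ∃ δ > 0, ∀ t, dist t x < δ → w t = 0 := by
      have h1 : (tsupport w)ᶜ ∈ 𝓝 x :=
        (isClosed_tsupport w).isOpen_compl.mem_nhds fun h' => hxs (hws h')
      obtain ⟨δ, hδ, h2⟩ := Metric.mem_nhds_iff.1 h1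
      exact ⟨δ, hδ, fun t ht => image_eq_zero_of_notMem_tsupport (h2 ht)⟩
    obtain ⟨δ₁, hδ₁, h1⟩ := hnear a (by simp)
    obtain ⟨δ₂, hδ₂, h2⟩ := hnear b (by simp)
    refine ⟨min δ₁ δ₂, lt_min hδ₁ hδ₂, fun s _ t ht htd => ?_⟩
    have hw0 : w t = 0 := by
      rcases htd with htd | htd
      · refine h1 t ?_
        rw [Real.dist_eq, abs_of_nonneg (by linarith [ht.1])]
        linarith [min_le_left δ₁ δ₂]
      · refine h2 t ?_
        rw [Real.dist_eq, abs_of_nonpos (by linarith [ht.2])]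
        linarith [min_le_right δ₁ δ₂]
    simp only [hw0, smul_zero, add_zero]
    exact hinv t ht

/-- The velocity of a variation in a chart. -/
theorem extChartAt_velocityLift_symm {a b s : ℝ} (hab : a < b) {x₀ : TangentBundle 𝓘(ℝ, E) Q}
    {u w : ℝ → E} (hu : ContDiffOn ℝ ∞ u (Icc a b)) (hw : ContDiff ℝ ∞ w)
    (hmem : ∀ t ∈ Icc a b, u t + s • w t ∈ (extChartAt 𝓘(ℝ, E) x₀.proj).target)
    {t : ℝ} (ht : t ∈ Icc a b) :
    extChartAt 𝓘(ℝ, E).tangent x₀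
        (velocityLift (fun t => (extChartAt 𝓘(ℝ, E) x₀.proj).symm (u t + s • w t)) (Icc a b) t) =
      (u t + s • w t, derivWithin u (Icc a b) t + s • deriv w t) ∧
    (extChartAt 𝓘(ℝ, E) x₀.proj).symm (u t + s • w t) ∈ (chartAt E x₀.proj).source := by
  have hsrc : (extChartAt 𝓘(ℝ, E) x₀.proj).symm (u t + s • w t) ∈ (chartAt E x₀.proj).source := by
    simpa using (extChartAt 𝓘(ℝ, E) x₀.proj).map_target (hmem t ht)
  refine ⟨?_, hsrc⟩
  have hd : HasDerivWithinAt (fun t => u t + s • w t)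
      (derivWithin u (Icc a b) t + s • deriv w t) (Icc a b) t :=
    (hu.differentiableOn (by simp) t ht).hasDerivWithinAt.add
      ((hw.differentiable (by simp) t).hasDerivAt.hasDerivWithinAt.const_smul s)
  have hm : MDifferentiableWithinAt 𝓘(ℝ, ℝ) 𝓘(ℝ, E)
      (fun t => (extChartAt 𝓘(ℝ, E) x₀.proj).symm (u t + s • w t)) (Icc a b) t :=
    MDifferentiableWithinAt.comp (g := (extChartAt 𝓘(ℝ, E) x₀.proj).symm)
      (f := fun t => u t + s • w t) t (mdifferentiableOn_extChartAt_symm _ (hmem t ht))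
      hd.differentiableWithinAt.mdifferentiableWithinAt hmem
  rw [extChartAt_velocityLift hsrc (uniqueDiffOn_Icc hab t ht) hm]
  refine Prod.ext ((extChartAt 𝓘(ℝ, E) x₀.proj).right_inv (hmem t ht)) ?_
  refine HasDerivWithinAt.derivWithin ?_ (uniqueDiffOn_Icc hab t ht)
  exact hd.congr (fun t ht => (extChartAt 𝓘(ℝ, E) x₀.proj).right_inv (hmem t ht))
    ((extChartAt 𝓘(ℝ, E) x₀.proj).right_inv (hmem t ht))

variable [FiniteDimensional ℝ E]

/-- In the interior of the parameter interval a unit speed geodesic satisfies the geodesic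
equation. -/
theorem IsUnitSpeedGeodesic.geodesic_equation_of_Icc_subset (hF : IsFinslerMetric F)
    (hγ : IsUnitSpeedGeodesic F γ J) (hJ : UniqueDiffOn ℝ J) {x₀ : TangentBundle 𝓘(ℝ, E) Q}
    {a b : ℝ} (hab : a < b) (hIJ : Icc a b ⊆ J)
    (hx : ∀ t ∈ Icc a b, γ t ∈ (chartAt E x₀.proj).source) {t : ℝ} (ht : t ∈ Ioo a b) :
    (derivWithin (fun s => extChartAt 𝓘(ℝ, E).tangent x₀ (velocityLift γ J s)) J t).2 =
      geodesicAcceleration (localMetric F x₀)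
        (extChartAt 𝓘(ℝ, E).tangent x₀ (velocityLift γ J t)) := by
  have hL := isLocalFinsler_localMetric hF x₀
  have hunit : ∀ t ∈ Icc a b, velocityLift γ J t ∈ unitBundle F := fun t ht =>
    hγ.unit_speed t (hIJ ht)
  have hyV : ∀ t ∈ Icc a b, (extChartAt 𝓘(ℝ, E).tangent x₀ (velocityLift γ J t)).1 ∈
      (extChartAt 𝓘(ℝ, E) x₀.proj).target := fun t ht =>
    mem_target_of_mem_source (x := velocityLift γ J t) (hx t ht)
  have hy0 : ∀ t ∈ Icc a b, (extChartAt 𝓘(ℝ, E).tangent x₀ (velocityLift γ J t)).2 ≠ 0 :=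
    fun t ht => (extChartAt_tangent_snd_ne_zero (x := velocityLift γ J t) (hx t ht)).2
      (snd_ne_zero_of_mem_unitBundle hF (hunit t ht))
  have hy : ContDiffOn ℝ ∞ (fun s => extChartAt 𝓘(ℝ, E).tangent x₀ (velocityLift γ J s))
      (Icc a b) := fun t ht =>
    (contDiffWithinAt_extChartAt_velocityLift hJ hγ.smooth (hIJ ht) (hx t ht)).mono hIJ
  have hder := fun t (ht : t ∈ Icc a b) =>
    (hasDerivWithinAt_extChartAt_velocityLift hJ hγ.smooth (x₀ := x₀) (hIJ ht) (hx t ht)).mono hIJ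
  have hval : ∀ t ∈ Icc a b, extChartAt 𝓘(ℝ, E).tangent x₀ (velocityLift γ J t) =
      (extChartAt 𝓘(ℝ, E) x₀.proj (γ t),
        derivWithin (fun t => extChartAt 𝓘(ℝ, E) x₀.proj (γ t)) (Icc a b) t) := by
    intro t ht
    rw [← velocityLift_eq_of_eqOn hIJ (fun _ _ => rfl) ht (uniqueDiffOn_Icc hab t ht)
      ((hγ.smooth t (hIJ ht)).mdifferentiableWithinAt (by simp))]
    exact extChartAt_velocityLift (hx t ht) (uniqueDiffOn_Icc hab t ht)
      (((hγ.smooth t (hIJ ht)).mono hIJ).mdifferentiableWithinAt (by simp))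
  refine hL.derivWithin_snd_eq_geodesicAcceleration hab hy hyV hy0
    (fun t ht => localMetric_eq_one (x := velocityLift γ J t) (hx t ht) (hunit t ht)) ?_ ht
    (hder t (Ioo_subset_Icc_self ht))
  intro ξ η hη hηs
  have hw : ContDiff ℝ ∞ fun t => η t • ξ := hη.smul contDiff_const
  have hw' : ContDiff ℝ ∞ fun t => deriv η t • ξ :=
    ((contDiff_infty_iff_deriv.1 hη).2).smul contDiff_const
  have hdw (t : ℝ) : deriv (fun t => η t • ξ) t = deriv η t • ξ :=
    ((hη.differentiable (by simp) t).hasDerivAt.smul_const ξ).deriv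
  have hws : tsupport (fun t => η t • ξ) ⊆ Ioo a b := by
    refine (closure_mono fun t ht => ?_).trans hηs
    intro h0
    exact ht (by simp [h0])
  have hu : ContDiffOn ℝ ∞ (fun t => extChartAt 𝓘(ℝ, E) x₀.proj (γ t)) (Icc a b) := fun t ht =>
    (contDiffWithinAt_extChartAt_curve hγ.smooth (hIJ ht) (hx t ht)).mono hIJ
  have hv : ContDiffOn ℝ ∞ (fun t => (extChartAt 𝓘(ℝ, E).tangent x₀ (velocityLift γ J t)).2)
      (Icc a b) := contDiff_snd.comp_contDiffOn hy
  obtain ⟨ε, hε, hmem⟩ := exists_pos_forall_add_smul_mem (isOpen_extChartAt_target x₀.proj)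
    hu.continuousOn hw.continuous hyV
  have h1 := hγ.critical a b hab hIJ ε _ (isVariation_extChartAt_symm (hγ.smooth.mono hIJ) hx
    hw hws hε hmem)
  have h2 := hL.hasDerivAt_integral_add_smul hab hu hv hw hw' hyV hy0
  refine (h2.congr_of_eventuallyEq ?_).unique h1
  filter_upwards [isOpen_Ioo.mem_nhds (show (0 : ℝ) ∈ Ioo (-ε) ε from ⟨by linarith, hε⟩)] with s hs
  refine intervalIntegral.integral_congr fun t ht => ?_
  rw [uIcc_of_le hab.le] at ht
  obtain ⟨h3, h4⟩ := extChartAt_velocityLift_symm hab (x₀ := x₀) hu hw (hmem s hs) ht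
  have h5 := localMetric_extChartAt (F := F) (x₀ := x₀) (x := velocityLift (fun t =>
    (extChartAt 𝓘(ℝ, E) x₀.proj).symm (extChartAt 𝓘(ℝ, E) x₀.proj (γ t) + s • η t • ξ))
    (Icc a b) t) h4
  rw [h3, hdw] at h5
  rw [hval t ht]
  exact h5.symm

/-- The geodesic equation also holds at the end points of the parameter interval, by continuity. -/
theorem IsUnitSpeedGeodesic.geodesic_equation (hF : IsFinslerMetric F)
    (hγ : IsUnitSpeedGeodesic F γ J) (hJ : J.OrdConnected) (hJ' : J.Nontrivial)
    {x₀ : TangentBundle 𝓘(ℝ, E) Q} {t : ℝ} (ht : t ∈ J)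
    (hx : γ t ∈ (chartAt E x₀.proj).source) :
    (derivWithin (fun s => extChartAt 𝓘(ℝ, E).tangent x₀ (velocityLift γ J s)) J t).2 =
      geodesicAcceleration (localMetric F x₀)
        (extChartAt 𝓘(ℝ, E).tangent x₀ (velocityLift γ J t)) := by
  have hJu := uniqueDiffOn_of_ordConnected hJ hJ'
  have hy := contDiffWithinAt_extChartAt_velocityLift hJu hγ.smooth ht hx
  have hc1 : ContinuousWithinAt (fun t =>
      (derivWithin (fun s => extChartAt 𝓘(ℝ, E).tangent x₀ (velocityLift γ J s)) J t).2) J t :=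
    continuous_snd.continuousAt.comp_continuousWithinAt
      (((hy.fderivWithin_right hJu (m := 0) (by simp) ht).clm_apply
        contDiffWithinAt_const).continuousWithinAt)
  have hc2 : ContinuousWithinAt (fun s => geodesicAcceleration (localMetric F x₀)
      (extChartAt 𝓘(ℝ, E).tangent x₀ (velocityLift γ J s))) J t :=
    ContinuousAt.comp_continuousWithinAt (g := geodesicAcceleration (localMetric F x₀))
      ((isLocalFinsler_localMetric hF x₀).contDiffAt_geodesicAcceleration
        (mem_target_of_mem_source (x := velocityLift γ J t) hx)
        ((extChartAt_tangent_snd_ne_zero (x := velocityLift γ J t) hx).2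
          (snd_ne_zero_of_mem_unitBundle hF (hγ.unit_speed t ht)))).continuousAt
      hy.continuousWithinAt
  have hne : (𝓝[interior J] t).NeBot :=
    mem_closure_iff_nhdsWithin_neBot.1 (subset_closure_interior_of_ordConnected hJ hJ' ht)
  refine tendsto_nhds_unique_of_eventuallyEq (hc1.mono interior_subset)
    (hc2.mono interior_subset) ?_
  have hev := eventually_mem_chart_source hγ.smooth ht hx
  rw [eventually_nhdsWithin_iff] at hev
  filter_upwards [nhdsWithin_le_nhds hev.eventually_nhds, self_mem_nhdsWithin] with r hr1 hr2
  have h1 : ∀ᶠ s in 𝓝 r, s ∈ J ∧ γ s ∈ (chartAt E x₀.proj).source := by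
    filter_upwards [hr1, mem_interior_iff_mem_nhds.1 hr2] with s hs1 hs2
    exact ⟨hs2, hs1 hs2⟩
  obtain ⟨δ, hδ, h2⟩ := Metric.eventually_nhds_iff.1 h1
  have h3 : ∀ s ∈ Icc (r - δ / 2) (r + δ / 2), s ∈ J ∧ γ s ∈ (chartAt E x₀.proj).source := by
    intro s hs
    refine h2 ?_
    rw [Real.dist_eq, abs_lt]
    constructor <;> linarith [hs.1, hs.2]
  exact hγ.geodesic_equation_of_Icc_subset hF hJu (by linarith) (fun s hs => (h3 s hs).1)
    (fun s hs => (h3 s hs).2) ⟨by linarith, by linarith⟩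

theorem IsUnitSpeedGeodesic.isMIntegralCurveOn (hF : IsFinslerMetric F)
    {R : (x : TangentBundle 𝓘(ℝ, E) Q) → TangentSpace 𝓘(ℝ, E).tangent x}
    (hR : IsReebVectorField F R) (hJ : J.OrdConnected) (hJ' : J.Nontrivial)
    (hγ : IsUnitSpeedGeodesic F γ J) :
    IsMIntegralCurveOn (I := 𝓘(ℝ, E).tangent) (velocityLift γ J) R J := by
  intro t ht
  have hJu := uniqueDiffOn_of_ordConnected hJ hJ'
  have hu : velocityLift γ J t ∈ unitBundle F := hγ.unit_speed t ht
  have hsrc : γ t ∈ (chartAt E (velocityLift (E := E) γ J t).proj).source := mem_chart_source E _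
  have hder := hasDerivWithinAt_extChartAt_velocityLift hJu hγ.smooth
    (x₀ := velocityLift γ J t) ht hsrc
  refine hasMFDerivWithinAt_of_hasDerivWithinAt ?_ (hder.congr_deriv ?_)
  · have h1 : ContinuousWithinAt (fun s => (extChartAt 𝓘(ℝ, E).tangent (velocityLift γ J t)).symm
        (extChartAt 𝓘(ℝ, E).tangent (velocityLift γ J t) (velocityLift γ J s))) J t :=
      ContinuousAt.comp_continuousWithinAt
        (g := (extChartAt 𝓘(ℝ, E).tangent (velocityLift γ J t)).symm)
        (continuousAt_extChartAt_symm _) hder.continuousWithinAt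
    refine h1.congr_of_eventuallyEq_of_mem ?_ ht
    filter_upwards [eventually_mem_chart_source hγ.smooth ht hsrc] with s hs
    exact ((extChartAt 𝓘(ℝ, E).tangent (velocityLift γ J t)).left_inv
      (mem_extChartAt_tangent_source.2 hs)).symm
  · rw [hγ.geodesic_equation hF hJ hJ' ht hsrc]
    exact ((isReebVector_iff_geodesicAcceleration hF (x := velocityLift γ J t) hsrc hu _).1
      (hR _ hu)).symm

end Geodesics

theorem proposition2p4 {E : Type*} [NormedAddCommGroup E] [NormedSpace ℝ E]
    [FiniteDimensional ℝ E] {Q : Type*} [TopologicalSpace Q] [T2Space Q] [ChartedSpace E Q]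
    [IsManifold 𝓘(ℝ, E) ∞ Q] (F : TangentBundle 𝓘(ℝ, E) Q → ℝ) (hF : IsFinslerMetric F) :
    IsContactOnUnitBundle F ∧
    (∀ x ∈ unitBundle F, ∃! r : TangentSpace 𝓘(ℝ, E).tangent x, IsReebVector F x r) ∧
    ∀ R : (x : TangentBundle 𝓘(ℝ, E) Q) → TangentSpace 𝓘(ℝ, E).tangent x,
      IsReebVectorField F R →
      ∀ J : Set ℝ, J.OrdConnected → J.Nontrivial → ∀ γ : ℝ → Q,
        IsUnitSpeedGeodesic F γ J ↔
          ∃ Γ : ℝ → TangentBundle 𝓘(ℝ, E) Q,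
            (∀ t ∈ J, Γ t ∈ unitBundle F) ∧
            IsMIntegralCurveOn (I := 𝓘(ℝ, E).tangent) Γ R J ∧
            ∀ t ∈ J, (Γ t).proj = γ t := by
  refine ⟨isContactOnUnitBundle hF, fun x hx => existsUnique_isReebVector hF hx, ?_⟩
  intro R hR J hJ hJ' γ
  constructor
  · intro hγ
    exact ⟨velocityLift γ J, hγ.unit_speed, hγ.isMIntegralCurveOn hF hR hJ hJ', fun _ _ => rfl⟩
  · rintro ⟨Γ, hu, hΓ, hproj⟩
    exact isUnitSpeedGeodesic_of_isMIntegralCurveOn hF hR (uniqueDiffOn_of_ordConnected hJ hJ') hu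
      hΓ hproj
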